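/- Let $(M,g,J)$ be a Hermitian surface: a smooth 4-manifold with a Riemannian metric $g$, Levi-Civita connection $\nabla$, and an integrable $g$-orthogonal almost complex structure $J$. Write $R(X,Y)Z=([\nabla_X,\nabla_Y]-\nabla_{[X,Y]})Z$ and $\Omega(X,Y)=g(JX,Y)$. Assume $|\nabla J|\neq 0$ everywhere, put $\alpha=\frac{1}{2\sqrt2}|\nabla J|$ and $\mathcal D=\{X:\nabla_XJ=0\}$, and assume that the natural opposite structure $\bar J$, defined by $\bar J=J$ on $\mathcal D^\perp$ and $\bar J=-J$ on $\mathcal D$, is Kähler. A standard frame is a local smooth orthonormal frame $E_1,\;E_2=JE_1$ of $\mathcal D^\perp$, $E_3,\;E_4=JE_3$ of $\mathcal D$, with dual coframe $\theta_i$, such that $\nabla\Omega=\alpha\big(\theta_1\otimes(\theta_1\wedge\theta_3-\theta_2\wedge\theta_4)+\theta_2\otimes(\theta_1\wedge\theta_4+\theta_2\wedge\theta_3)\big)$. (1) Assume that the Ricci tensor is $J$-invariant. If $(M,g,\bar J)$ is semi-symmetric ($R\cdot R=0$) and foliated by Euclidean spaces, in the sense that the curvature nullity space $\{u\in T_xM: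 R(u,v)w=0\ \text{for all } v,w\in T_xM\}$ has dimension at least $2$ at every point $x$, then $E_4\ln\alpha=\frac12\alpha$ in every standard frame. (2) Conversely, suppose that $(M,g,\bar J)$ is a QCH Kähler surface with respect to $\mathcal D$, i.e. for unit vectors $X\in T_xM$ the number $g(R(X,\bar JX)\bar JX,X)$ depends only on $x$ and on the length of the orthogonal projection of $X$ onto $\mathcal D$. If $E_4\ln\alpha=\frac12\alpha$ in every standard frame, then $(M,g,\bar J)$ is semi-symmetric, and moreover $\tau-\kappa=0$, where $\tau$ is the scalar curvature, $\kappa=\tau-6(|\theta|^2+\delta\theta)$ is the conformal scalar curvature of $(M,g,J)$, and $\theta$ is the Lee form, defined by $d\Omega=2\theta\wedge\Omega$. -/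

import Mathlib

open Bundle Manifold
open scoped ContDiff Topology

noncomputable section

instance TangentSpace.finiteDimensional4 {M : Type*} [TopologicalSpace M] [ChartedSpace (EuclideanSpace ℝ (Fin 4)) M] (x : M) :
    FiniteDimensional ℝ (TangentSpace (𝓡 4) x) :=
  inferInstanceAs (FiniteDimensional ℝ (EuclideanSpace ℝ (Fin 4)))

namespace HermSurf

variable {M : Type*} [TopologicalSpace M] [ChartedSpace (EuclideanSpace ℝ (Fin 4)) M] [IsManifold (𝓡 4) ∞ M]
  [RiemannianBundle (fun x : M => TangentSpace (𝓡 4) x)]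

/-- The derivative `v(f)` of a real function along a tangent vector at `x`. -/
def dirDeriv (f : M → ℝ) (x : M) (v : TangentSpace (𝓡 4) x) : ℝ :=
  mfderiv (𝓡 4) 𝓘(ℝ, ℝ) f x v

/-- The vector field `X` is smooth on `U`. -/
def SmoothFieldOn (X : (y : M) → TangentSpace (𝓡 4) y) (U : Set M) : Prop :=
  ContMDiffOn (𝓡 4) ((𝓡 4).prod 𝓘(ℝ, EuclideanSpace ℝ (Fin 4))) ∞
    (fun y => TotalSpace.mk' (EuclideanSpace ℝ (Fin 4)) (E := fun y : M => TangentSpace (𝓡 4) y)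
      y (X y)) U

/-- The vector field `X` is smooth at `x`. -/
def SmoothFieldAt (X : (y : M) → TangentSpace (𝓡 4) y) (x : M) : Prop :=
  ContMDiffAt (𝓡 4) ((𝓡 4).prod 𝓘(ℝ, EuclideanSpace ℝ (Fin 4))) ∞
    (fun y => TotalSpace.mk' (EuclideanSpace ℝ (Fin 4)) (E := fun y : M => TangentSpace (𝓡 4) y)
      y (X y)) x

/-- A connection on the tangent bundle. `cov Y x v` is `(∇_v Y)(x)`. -/
abbrev Connection (M : Type*) [TopologicalSpace M] [ChartedSpace (EuclideanSpace ℝ (Fin 4)) M]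
    [IsManifold (𝓡 4) ∞ M] :=
  CovariantDerivative (𝓡 4) (EuclideanSpace ℝ (Fin 4)) (fun x : M => TangentSpace (𝓡 4) x)

set_option synthInstance.maxHeartbeats 400000 in
/-- `cov` is the Levi-Civita connection of the metric: the smooth connection that is
compatible with the metric and has no torsion. -/
structure IsLeviCivita
    [IsContMDiffRiemannianBundle (𝓡 4) ∞ (EuclideanSpace ℝ (Fin 4)) (fun x : M => TangentSpace (𝓡 4) x)]
    (cov : Connection M) : Prop where
  smooth : CovariantDerivative.ContMDiffCovariantDerivative cov ∞
  metric : cov.IsMetricCompatible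
  torsionFree : cov.torsion = 0

/-- A smooth extension of the tangent vector `v` to a vector field near `x`. -/
def ext {x : M} (v : TangentSpace (𝓡 4) x) : (y : M) → TangentSpace (𝓡 4) y :=
  FiberBundle.extend (EuclideanSpace ℝ (Fin 4)) v

/-! ### Curvature -/

/-- The curvature `R(X,Y)Z = ∇_X ∇_Y Z - ∇_Y ∇_X Z - ∇_[X,Y] Z` on vector fields. -/
def curvField (cov : Connection M) (X Y Z : (y : M) → TangentSpace (𝓡 4) y) (x : M) : TangentSpace (𝓡 4) x :=
  cov (fun y => cov Z y (Y y)) x (X x) - cov (fun y => cov Z y (X y)) x (Y x)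
    - cov Z x (VectorField.mlieBracket (𝓡 4) X Y x)

/-- The curvature tensor `R(u,v)w` on tangent vectors at `x`. -/
def R (cov : Connection M) (x : M) (u v w : TangentSpace (𝓡 4) x) : TangentSpace (𝓡 4) x :=
  curvField cov (ext u) (ext v) (ext w) x

/-- An orthonormal basis of the tangent space, used to take traces. -/
def onb (x : M) : OrthonormalBasis (Fin (Module.finrank ℝ (TangentSpace (𝓡 4) x))) ℝ (TangentSpace (𝓡 4) x) :=
  stdOrthonormalBasis ℝ (TangentSpace (𝓡 4) x)

/-- The Ricci tensor `ρ(u,v) = tr {z ↦ R(z,u)v}`. -/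
def ricci (cov : Connection M) (x : M) (u v : TangentSpace (𝓡 4) x) : ℝ :=
  ∑ i, inner ℝ (R cov x (onb x i) u v) (onb x i)

/-- The scalar curvature `τ = tr_g ρ`. -/
def scalarCurv (cov : Connection M) (x : M) : ℝ :=
  ∑ i, ricci cov x (onb x i) (onb x i)

/-- Semi-symmetry `R.R = 0`: each endomorphism `R(u,v)`, acting as a derivation of the tensor
algebra, annihilates the curvature tensor. -/
def IsSemiSymmetric (cov : Connection M) : Prop :=
  ∀ (x : M) (u v a b c : TangentSpace (𝓡 4) x),
    R cov x u v (R cov x a b c) - R cov x (R cov x u v a) b c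
      - R cov x a (R cov x u v b) c - R cov x a b (R cov x u v c) = 0

/-- Foliated by Euclidean spaces (of codimension two): at each point the curvature nullity space
`{u | R(u,·)· = 0}` contains a 2-plane, that is, the nullity index is at least `4 - 2`.
Where the nullity index is exactly 2, the nullity spaces are tangent to a foliation whose leaves
are automatically totally geodesic and flat. -/
def IsFoliatedByEuclidean (cov : Connection M) : Prop :=
  ∀ x : M, ∃ N : Submodule ℝ (TangentSpace (𝓡 4) x), Module.finrank ℝ N = 2 ∧
    ∀ u ∈ N, ∀ v w : TangentSpace (𝓡 4) x, R cov x u v w = 0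

/-! ### Almost Hermitian structures -/

/-- `J` is a smooth almost complex structure, orthogonal for the metric. -/
structure IsAlmostHermitian (J : (x : M) → TangentSpace (𝓡 4) x →L[ℝ] TangentSpace (𝓡 4) x) : Prop where
  smooth : ContMDiff (𝓡 4) ((𝓡 4).prod 𝓘(ℝ, EuclideanSpace ℝ (Fin 4) →L[ℝ] EuclideanSpace ℝ (Fin 4))) ∞
    (fun x => TotalSpace.mk' (EuclideanSpace ℝ (Fin 4) →L[ℝ] EuclideanSpace ℝ (Fin 4))
      (E := fun x : M => TangentSpace (𝓡 4) x →L[ℝ] TangentSpace (𝓡 4) x) x (J x))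
  sq : ∀ (x : M) (v : TangentSpace (𝓡 4) x), J x (J x v) = -v
  orthogonal : ∀ (x : M) (v w : TangentSpace (𝓡 4) x), inner ℝ (J x v) (J x w) = inner ℝ v w

/-- The Nijenhuis tensor `N(X,Y) = [JX,JY] - J[JX,Y] - J[X,JY] - [X,Y]` on vector fields. -/
def nijenhuis (J : (x : M) → TangentSpace (𝓡 4) x →L[ℝ] TangentSpace (𝓡 4) x) (X Y : (y : M) → TangentSpace (𝓡 4) y) (x : M) : TangentSpace (𝓡 4) x :=
  VectorField.mlieBracket (𝓡 4) (fun y => J y (X y)) (fun y => J y (Y y)) x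
    - J x (VectorField.mlieBracket (𝓡 4) (fun y => J y (X y)) Y x)
    - J x (VectorField.mlieBracket (𝓡 4) X (fun y => J y (Y y)) x)
    - VectorField.mlieBracket (𝓡 4) X Y x

/-- `(M,g,J)` is a Hermitian surface. -/
structure IsHermitian (J : (x : M) → TangentSpace (𝓡 4) x →L[ℝ] TangentSpace (𝓡 4) x) : Prop extends IsAlmostHermitian J where
  integrable : ∀ (x : M) (X Y : (y : M) → TangentSpace (𝓡 4) y),
    SmoothFieldAt X x → SmoothFieldAt Y x → nijenhuis J X Y x = 0

/-- `v ↦ (∇_v J) w = ∇_v (J W) - J (∇_v W)`, where `W` extends `w`. -/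
def nablaJ (cov : Connection M) (J : (x : M) → TangentSpace (𝓡 4) x →L[ℝ] TangentSpace (𝓡 4) x) (x : M) (w : TangentSpace (𝓡 4) x) :
    TangentSpace (𝓡 4) x →L[ℝ] TangentSpace (𝓡 4) x :=
  cov (fun y => J y (ext w y)) x - (J x).comp (cov (ext w) x)

/-- `(M,g,J)` is a Kähler surface. -/
structure IsKahler (cov : Connection M) (J : (x : M) → TangentSpace (𝓡 4) x →L[ℝ] TangentSpace (𝓡 4) x) : Prop
    extends IsAlmostHermitian J where
  parallel : ∀ (x : M) (v w : TangentSpace (𝓡 4) x), nablaJ cov J x w v = 0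

/-- The norm `|∇J|`. -/
def normNablaJ (cov : Connection M) (J : (x : M) → TangentSpace (𝓡 4) x →L[ℝ] TangentSpace (𝓡 4) x) (x : M) : ℝ :=
  √(∑ i, ∑ j, ‖nablaJ cov J x (onb x j) (onb x i)‖ ^ 2)

/-- The function `α = |∇J| / (2√2)`. -/
def alpha (cov : Connection M) (J : (x : M) → TangentSpace (𝓡 4) x →L[ℝ] TangentSpace (𝓡 4) x) (x : M) : ℝ :=
  1 / (2 * √2) * normNablaJ cov J x

/-- The nullity distribution `𝒟 = {v | ∇_v J = 0}`. -/
def nullityJ (cov : Connection M) (J : (x : M) → TangentSpace (𝓡 4) x →L[ℝ] TangentSpace (𝓡 4) x) (x : M) :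
    Submodule ℝ (TangentSpace (𝓡 4) x) :=
  ⨅ w : TangentSpace (𝓡 4) x, LinearMap.ker (nablaJ cov J x w).toLinearMap

/-- The natural opposite structure `J̄`: equal to `J` on `𝒟ᗮ` and to `-J` on `𝒟`. -/
def natOpp (cov : Connection M) (J : (x : M) → TangentSpace (𝓡 4) x →L[ℝ] TangentSpace (𝓡 4) x) (x : M) : TangentSpace (𝓡 4) x →L[ℝ] TangentSpace (𝓡 4) x :=
  (J x).comp (ContinuousLinearMap.id ℝ (TangentSpace (𝓡 4) x) - (2 : ℝ) • (nullityJ cov J x).starProjection)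

/-- The Ricci tensor is Hermitian (`J`-invariant). -/
def RicciInvariant (cov : Connection M) (J : (x : M) → TangentSpace (𝓡 4) x →L[ℝ] TangentSpace (𝓡 4) x) : Prop :=
  ∀ (x : M) (v w : TangentSpace (𝓡 4) x), ricci cov x (J x v) (J x w) = ricci cov x v w

/-- `(M,g,J)` is a QCH Kähler surface with respect to the distribution `𝒟`: the holomorphic
curvature `R(v,Jv,Jv,v)` of a unit vector `v` at `x` depends only on `x` and on the length of the
orthogonal projection of `v` onto `𝒟`. -/
structure IsQCH (cov : Connection M) (J : (x : M) → TangentSpace (𝓡 4) x →L[ℝ] TangentSpace (𝓡 4) x)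
    (D : (x : M) → Submodule ℝ (TangentSpace (𝓡 4) x)) : Prop where
  kahler : IsKahler cov J
  holCurv : ∀ (x : M) (v w : TangentSpace (𝓡 4) x), ‖v‖ = 1 → ‖w‖ = 1 →
    ‖(D x).starProjection v‖ = ‖(D x).starProjection w‖ →
    inner ℝ (R cov x v (J x v) (J x v)) v = inner ℝ (R cov x w (J x w) (J x w)) w

/-! ### Lee form and conformal scalar curvature -/

/-- The Kähler form `Ω(v,w) = g(Jv,w)`. -/
def kahlerForm (J : (x : M) → TangentSpace (𝓡 4) x →L[ℝ] TangentSpace (𝓡 4) x) (x : M) (v w : TangentSpace (𝓡 4) x) : ℝ :=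
  inner ℝ (J x v) w

/-- The exterior derivative of the Kähler form on vector fields. -/
def dKahlerForm (J : (x : M) → TangentSpace (𝓡 4) x →L[ℝ] TangentSpace (𝓡 4) x) (X Y Z : (y : M) → TangentSpace (𝓡 4) y) (x : M) : ℝ :=
  dirDeriv (fun y => kahlerForm J y (Y y) (Z y)) x (X x)
    + dirDeriv (fun y => kahlerForm J y (Z y) (X y)) x (Y x)
    + dirDeriv (fun y => kahlerForm J y (X y) (Y y)) x (Z x)
    - kahlerForm J x (VectorField.mlieBracket (𝓡 4) X Y x) (Z x)
    - kahlerForm J x (VectorField.mlieBracket (𝓡 4) Y Z x) (X x)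
    - kahlerForm J x (VectorField.mlieBracket (𝓡 4) Z X x) (Y x)

/-- `θ` is the Lee form of `(M,g,J)`: the 1-form with `dΩ = 2 θ ∧ Ω`. -/
structure IsLeeForm (J : (x : M) → TangentSpace (𝓡 4) x →L[ℝ] TangentSpace (𝓡 4) x) (θ : (x : M) → TangentSpace (𝓡 4) x →L[ℝ] ℝ) : Prop where
  smooth : ∀ (x : M) (X : (y : M) → TangentSpace (𝓡 4) y), SmoothFieldAt X x →
    ContMDiffAt (𝓡 4) 𝓘(ℝ, ℝ) ∞ (fun y => θ y (X y)) x
  eq : ∀ (x : M) (X Y Z : (y : M) → TangentSpace (𝓡 4) y),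
    SmoothFieldAt X x → SmoothFieldAt Y x → SmoothFieldAt Z x →
    dKahlerForm J X Y Z x =
      2 * (θ x (X x) * kahlerForm J x (Y x) (Z x) + θ x (Y x) * kahlerForm J x (Z x) (X x)
        + θ x (Z x) * kahlerForm J x (X x) (Y x))

/-- The squared norm `|θ|²` of a 1-form. -/
def normSqForm (θ : (x : M) → TangentSpace (𝓡 4) x →L[ℝ] ℝ) (x : M) : ℝ :=
  ∑ i, θ x (onb x i) ^ 2

/-- The codifferential `δθ = -tr ∇θ` of a 1-form, with `(∇_v θ)(w) = v(θ(W)) - θ(∇_v W)`. -/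
def codiff (cov : Connection M) (θ : (x : M) → TangentSpace (𝓡 4) x →L[ℝ] ℝ) (x : M) : ℝ :=
  -∑ i, (dirDeriv (fun y => θ y (ext (onb x i) y)) x (onb x i)
    - θ x (cov (ext (onb x i)) x (onb x i)))

/-- The conformal scalar curvature `κ = τ - 6(|θ|² + δθ)`, where `θ` is the Lee form. -/
def conformalScalar (cov : Connection M) (θ : (x : M) → TangentSpace (𝓡 4) x →L[ℝ] ℝ) (x : M) : ℝ :=
  scalarCurv cov x - 6 * (normSqForm θ x + codiff cov θ x)

/-! ### Standard frames -/

/-- `e 0, e 1, e 2, e 3` (written `E₁, E₂, E₃, E₄` on paper) is a standard frame of `(M,g,J)` on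
the open set `U`: a smooth orthonormal frame with `E₁, E₂ = J E₁` in `𝒟ᗮ` and `E₃, E₄ = J E₃` in
`𝒟`, such that `∇Ω = α (θ₁ ⊗ (θ₁∧θ₃ - θ₂∧θ₄) + θ₂ ⊗ (θ₁∧θ₄ + θ₂∧θ₃))` for the dual coframe;
here `(∇_u Ω)(v,w) = g((∇_u J)v, w)` as the metric is parallel. -/
structure IsStandardFrame (cov : Connection M) (J : (x : M) → TangentSpace (𝓡 4) x →L[ℝ] TangentSpace (𝓡 4) x)
    (U : Set M) (e : Fin 4 → (x : M) → TangentSpace (𝓡 4) x) : Prop where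
  isOpen : IsOpen U
  smooth : ∀ i, SmoothFieldOn (e i) U
  orthonormal : ∀ x ∈ U, Orthonormal ℝ (fun i => e i x)
  perp : ∀ x ∈ U, e 0 x ∈ (nullityJ cov J x)ᗮ ∧ e 1 x ∈ (nullityJ cov J x)ᗮ
  null : ∀ x ∈ U, e 2 x ∈ nullityJ cov J x ∧ e 3 x ∈ nullityJ cov J x
  oriented : ∀ x ∈ U, J x (e 0 x) = e 1 x ∧ J x (e 2 x) = e 3 x
  nablaOmega : ∀ x ∈ U, ∀ u v w : TangentSpace (𝓡 4) x,
    let θ : Fin 4 → TangentSpace (𝓡 4) x → ℝ := fun i a => inner ℝ (e i x) a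
    let wedge : Fin 4 → Fin 4 → ℝ := fun i j => θ i v * θ j w - θ j v * θ i w
    inner ℝ (nablaJ cov J x v u) w =
      alpha cov J x * (θ 0 u * (wedge 0 2 - wedge 1 3) + θ 1 u * (wedge 0 3 + wedge 1 2))

/-- `E₄ ln α = α/2` in every standard frame. -/
def E4LogAlphaEq (cov : Connection M) (J : (x : M) → TangentSpace (𝓡 4) x →L[ℝ] TangentSpace (𝓡 4) x) : Prop :=
  ∀ (U : Set M) (e : Fin 4 → (x : M) → TangentSpace (𝓡 4) x), IsStandardFrame cov J U e →
    ∀ x ∈ U, dirDeriv (fun y => Real.log (alpha cov J y)) x (e 3 x) = alpha cov J x / 2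

end HermSurf

end

/-!
Throughout, `J̄ = natOpp cov J` is parallel, `P` is the orthogonal projection onto the nullity
distribution `𝒟` of `∇J`, and `q = ⟨∇_{E₃}E₃, E₄⟩` in a standard frame.

*Connection forms.* Since `J̄` agrees with `J` on `𝒟ᗮ` and is parallel, comparing `∇(J E₁)` with
`∇(J̄ E₁)` expresses every mixed connection form `⟨∇E_i, E_j⟩` (`i ≤ 2 < j`) through `∇J`, that is,
through `α` (`IsStandardFrame.inner_cov`). The structure equations then give
`⟨R(E₂,E₄)E₁,E₃⟩ = E₄(α)/2 - α²/4` (`inner_R_one_three`) and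
`⟨R(E₁,E₃)E₁,E₃⟩ = α q/2 - α²/4` (`inner_R_zero_two_self`). As `R` is the curvature of a Kähler
metric, `R(J̄u,J̄v) = R(u,v)`, and the two components differ only in sign:
`E₄(α) + α q = α²` (`dirDeriv_alpha_add`). Hence `E₄ ln α = α/2` holds exactly when the mixed
component vanishes.

*Part (1).* The nullity space of a Kähler curvature tensor is `J̄`-invariant. As soon as it is
nonzero it therefore contains a `J̄`-invariant plane, and one sectional curvature `K`, of the
orthogonal plane spanned by `f₃, f₄ = J̄f₃`, determines the curvature; the Ricci tensor is
`K (f₃ ⊗ f₃ + f₄ ⊗ f₄)`. If `K ≠ 0`, `J`-invariance of the Ricci tensor forces this plane to be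
invariant under both `J` and `J̄`, hence to be `𝒟` or `𝒟ᗮ`; in all cases the mixed component is zero
(`IsKahlerCurvature.mixed_eq_zero_of_nullity`).

*Part (2).* The condition on the holomorphic curvature, polarised along vectors
`a E₁ + b E₂ + c E₃ + d E₄`, determines a Kähler curvature tensor up to three constants. The mixed
component is one of them, and when it vanishes the curvature tensor is that of a product of two
surfaces (`IsKahlerCurvature.product_of_holCurv`), which is semi-symmetric. The Lee form is
`θ = -α θ₄`, because `dΩ` is the cyclic sum of `∇Ω`; then `|θ|² = α²` and
`δθ = E₄(α) - α² - α q`, so that `|θ|² + δθ = E₄(α) - α q = 0`.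

Part (2) needs standard frames to exist near every point (`exists_isStandardFrame`). Integrability
of `J` means `∇_{Jv}J = J ∇_vJ`, so `𝒟` is `J`-invariant. From `J J̄ = 2P - 1` one sees that `P` is
smooth, and that `∇P = ½ (∇J) J̄` vanishes nowhere, whereas `P² = P` would give `∇P = 0` at a point
where `P = 0`; so `𝒟 ≠ 0`. For a unit section `E₁` of `𝒟ᗮ` the vector
`(∇_{E₁}J)E₁` lies in `𝒟` and has norm `α`; its normalisation is `E₃`.
-/

noncomputable section

namespace HermSurf

variable {M : Type*} [TopologicalSpace M] [ChartedSpace (EuclideanSpace ℝ (Fin 4)) M]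
  [IsManifold (𝓡 4) ∞ M]

set_option linter.unusedSectionVars false

/-! ### Smooth vector fields near a point -/

/-- Vector fields on `M`, without any regularity. -/
abbrev Field (M : Type*) [TopologicalSpace M] [ChartedSpace (EuclideanSpace ℝ (Fin 4)) M] :
    Type _ :=
  (y : M) → TangentSpace (𝓡 4) y

/-- The vector field `X` is smooth at all points near `x`. This is stronger than
`SmoothFieldAt X x`, which for each finite order only asks for a neighbourhood depending on that
order; it is the condition that survives covariant differentiation. -/
def SmoothNear (X : Field M) (x : M) : Prop := ∀ᶠ y in 𝓝 x, SmoothFieldAt X y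

/-- The vector field `X` is differentiable at `x`. -/
def DiffFieldAt (X : Field M) (x : M) : Prop :=
  MDifferentiableAt (𝓡 4) ((𝓡 4).prod 𝓘(ℝ, EuclideanSpace ℝ (Fin 4)))
    (fun y => TotalSpace.mk' (EuclideanSpace ℝ (Fin 4)) (E := fun y : M => TangentSpace (𝓡 4) y)
      y (X y)) x

lemma SmoothFieldAt.diffFieldAt {X : Field M} {x : M} (h : SmoothFieldAt X x) : DiffFieldAt X x :=
  ContMDiffAt.mdifferentiableAt h (by simp)

lemma SmoothNear.smoothFieldAt {X : Field M} {x : M} (h : SmoothNear X x) : SmoothFieldAt X x :=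
  h.self_of_nhds

lemma SmoothNear.diffFieldAt {X : Field M} {x : M} (h : SmoothNear X x) : DiffFieldAt X x :=
  h.smoothFieldAt.diffFieldAt

lemma SmoothNear.eventually {X : Field M} {x : M} (h : SmoothNear X x) :
    ∀ᶠ y in 𝓝 x, SmoothNear X y :=
  eventually_eventually_nhds.2 h

lemma SmoothFieldOn.smoothNear {X : Field M} {U : Set M} (h : SmoothFieldOn X U) (hU : IsOpen U)
    {x : M} (hx : x ∈ U) : SmoothNear X x := by
  filter_upwards [hU.mem_nhds hx] with y hy
  exact ContMDiffOn.contMDiffAt h (hU.mem_nhds hy)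

lemma smoothNear_ext {x : M} (v : TangentSpace (𝓡 4) x) : SmoothNear (ext v) x := by
  obtain ⟨s, hs, h⟩ := FiberBundle.exists_contMDiffOn_extend (k := ∞) (𝓡 4)
    (EuclideanSpace ℝ (Fin 4)) v
  filter_upwards [eventually_mem_nhds_iff.2 hs] with y hy
  exact h.contMDiffAt hy

@[simp] lemma ext_self {x : M} (v : TangentSpace (𝓡 4) x) : ext v x = v :=
  FiberBundle.extend_apply_self _ v

lemma SmoothNear.congr {X Y : Field M} {x : M} (h : SmoothNear X x) (hXY : ∀ᶠ y in 𝓝 x, Y y = X y) :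
    SmoothNear Y x := by
  filter_upwards [h, eventually_eventually_nhds.2 hXY] with y hy hy'
  refine ContMDiffAt.congr_of_eventuallyEq hy ?_
  filter_upwards [hy'] with z hz
  rw [hz]

lemma SmoothNear.add {X Y : Field M} {x : M} (hX : SmoothNear X x) (hY : SmoothNear Y x) :
    SmoothNear (X + Y) x := by
  filter_upwards [hX, hY] with y h1 h2 using ContMDiffAt.add_section h1 h2

lemma SmoothNear.sub {X Y : Field M} {x : M} (hX : SmoothNear X x) (hY : SmoothNear Y x) :
    SmoothNear (X - Y) x := by
  filter_upwards [hX, hY] with y h1 h2 using ContMDiffAt.sub_section h1 h2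

/-- The function `f` is smooth at all points near `x`. -/
def SmoothFunNear (f : M → ℝ) (x : M) : Prop := ∀ᶠ y in 𝓝 x, ContMDiffAt (𝓡 4) 𝓘(ℝ, ℝ) ∞ f y

lemma SmoothFunNear.mdiffAt {f : M → ℝ} {x : M} (h : SmoothFunNear f x) :
    MDifferentiableAt (𝓡 4) 𝓘(ℝ, ℝ) f x :=
  h.self_of_nhds.mdifferentiableAt (by simp)

lemma SmoothNear.smul {f : M → ℝ} {X : Field M} {x : M} (hf : SmoothFunNear f x)
    (hX : SmoothNear X x) : SmoothNear (f • X) x := by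
  filter_upwards [hf, hX] with y h1 h2 using ContMDiffAt.smul_section h1 h2

lemma SmoothNear.const_smul {X : Field M} {x : M} (c : ℝ)
    (hX : SmoothNear X x) : SmoothNear (c • X) x := by
  filter_upwards [hX] with y h2 using ContMDiffAt.const_smul_section h2

lemma DiffFieldAt.smul {f : M → ℝ} {Y : Field M} {x : M}
    (hf : MDifferentiableAt (𝓡 4) 𝓘(ℝ, ℝ) f x) (hY : DiffFieldAt Y x) :
    DiffFieldAt (f • Y) x := hf.smul_section hY

lemma DiffFieldAt.congr {X Y : Field M} {x : M} (h : DiffFieldAt X x)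
    (hXY : ∀ᶠ y in 𝓝 x, Y y = X y) : DiffFieldAt Y x := by
  refine MDifferentiableAt.congr_of_eventuallyEq h ?_
  filter_upwards [hXY] with z hz
  rw [hz]

/-- A field of endomorphisms of the tangent bundle which is smooth at `x`. -/
def SmoothEndAt (A : (x : M) → TangentSpace (𝓡 4) x →L[ℝ] TangentSpace (𝓡 4) x) (x : M) : Prop :=
  ContMDiffAt (𝓡 4) ((𝓡 4).prod 𝓘(ℝ, EuclideanSpace ℝ (Fin 4) →L[ℝ] EuclideanSpace ℝ (Fin 4))) ∞
    (fun x => TotalSpace.mk' (EuclideanSpace ℝ (Fin 4) →L[ℝ] EuclideanSpace ℝ (Fin 4))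
      (E := fun x : M => TangentSpace (𝓡 4) x →L[ℝ] TangentSpace (𝓡 4) x) x (A x)) x

lemma SmoothEndAt.apply_smooth
    {A : (x : M) → TangentSpace (𝓡 4) x →L[ℝ] TangentSpace (𝓡 4) x} {X : Field M} {x : M}
    (hA : SmoothEndAt A x) (hX : SmoothFieldAt X x) : SmoothFieldAt (fun y => A y (X y)) x :=
  ContMDiffAt.clm_bundle_apply (F₁ := EuclideanSpace ℝ (Fin 4))
    (F₂ := EuclideanSpace ℝ (Fin 4)) hA hX

lemma SmoothEndAt.apply_diff
    {A : (x : M) → TangentSpace (𝓡 4) x →L[ℝ] TangentSpace (𝓡 4) x} {X : Field M} {x : M}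
    (hA : SmoothEndAt A x) (hX : DiffFieldAt X x) : DiffFieldAt (fun y => A y (X y)) x :=
  MDifferentiableAt.clm_bundle_apply (F₁ := EuclideanSpace ℝ (Fin 4))
    (F₂ := EuclideanSpace ℝ (Fin 4)) (ContMDiffAt.mdifferentiableAt hA (by simp)) hX

/-! ### Covariant derivatives -/

lemma dirDeriv_eq (f : M → ℝ) (x : M) (v : TangentSpace (𝓡 4) x) :
    dirDeriv f x v = mvfderiv (𝓡 4) f x v := rfl

lemma dirDeriv_congr {f g : M → ℝ} {x : M} (h : ∀ᶠ y in 𝓝 x, f y = g y)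
    (v : TangentSpace (𝓡 4) x) : dirDeriv f x v = dirDeriv g x v := by
  unfold dirDeriv
  rw [Filter.EventuallyEq.mfderiv_eq h]
  rfl

lemma dirDeriv_const (c : ℝ) (x : M) (v : TangentSpace (𝓡 4) x) :
    dirDeriv (fun _ => c) x v = 0 := by
  unfold dirDeriv
  rw [mfderiv_const]
  rfl

lemma dirDeriv_add {f g : M → ℝ} {x : M}
    (hf : MDifferentiableAt (𝓡 4) 𝓘(ℝ, ℝ) f x) (hg : MDifferentiableAt (𝓡 4) 𝓘(ℝ, ℝ) g x)
    (v : TangentSpace (𝓡 4) x) :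
    dirDeriv (fun y => f y + g y) x v = dirDeriv f x v + dirDeriv g x v := by
  simp only [dirDeriv_eq]
  rw [mvfderiv_fun_add hf hg]
  rfl

lemma dirDeriv_const_mul {f : M → ℝ} {x : M} (c : ℝ) (hf : MDifferentiableAt (𝓡 4) 𝓘(ℝ, ℝ) f x)
    (v : TangentSpace (𝓡 4) x) :
    dirDeriv (fun y => c * f y) x v = c * dirDeriv f x v := by
  simp only [dirDeriv_eq]
  rw [mvfderiv_fun_mul mdifferentiableAt_const hf]
  have := dirDeriv_const c x v
  rw [dirDeriv_eq] at this
  simp [this]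

lemma dirDeriv_log {f : M → ℝ} {x : M} (hf : MDifferentiableAt (𝓡 4) 𝓘(ℝ, ℝ) f x) (h0 : f x ≠ 0)
    (v : TangentSpace (𝓡 4) x) :
    dirDeriv (fun y => Real.log (f y)) x v = (f x)⁻¹ * dirDeriv f x v := by
  have h1 : HasMFDerivAt 𝓘(ℝ, ℝ) 𝓘(ℝ, ℝ) Real.log (f x)
      (ContinuousLinearMap.toSpanSingleton ℝ ((f x)⁻¹ : ℝ) : ℝ →L[ℝ] ℝ) :=
    (Real.hasDerivAt_log h0).hasFDerivAt.hasMFDerivAt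
  have := (h1.comp x hf.hasMFDerivAt).mfderiv
  unfold dirDeriv
  change mfderiv (𝓡 4) 𝓘(ℝ, ℝ) (Real.log ∘ f) x v = _
  rw [this]
  change (dirDeriv f x v) • (f x)⁻¹ = (f x)⁻¹ * dirDeriv f x v
  rw [smul_eq_mul, mul_comm]

section Connection

variable (cov : Connection M)

lemma cov_congr {X Y : Field M} {x : M} (hX : DiffFieldAt X x)
    (h : ∀ᶠ y in 𝓝 x, X y = Y y) : cov X x = cov Y x :=
  cov.isCovariantDerivativeOnUniv.congr_of_eventuallyEq hX
    (hX.congr (h.mono fun _ h => h.symm)) Filter.univ_mem h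

lemma cov_add {X Y : Field M} {x : M} (hX : DiffFieldAt X x) (hY : DiffFieldAt Y x) :
    cov (X + Y) x = cov X x + cov Y x :=
  cov.isCovariantDerivativeOnUniv.add hX hY

lemma cov_smul {f : M → ℝ} {X : Field M} {x : M}
    (hf : MDifferentiableAt (𝓡 4) 𝓘(ℝ, ℝ) f x) (hX : DiffFieldAt X x)
    (v : TangentSpace (𝓡 4) x) :
    cov (f • X) x v = f x • cov X x v + dirDeriv f x v • X x := by
  rw [cov.isCovariantDerivativeOnUniv.leibniz hX hf]
  rfl

lemma cov_const_smul (c : ℝ) {X : Field M} {x : M} (hX : DiffFieldAt X x) :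
    cov (c • X) x = c • cov X x :=
  cov.isCovariantDerivativeOnUniv.smul_const c hX

lemma cov_neg {X : Field M} {x : M} (hX : DiffFieldAt X x) :
    cov (-X) x = - cov X x := by
  have := cov_const_smul cov (-1) hX
  simpa using this

lemma cov_sub {X Y : Field M} {x : M} (hX : DiffFieldAt X x) (hY : DiffFieldAt Y x) :
    cov (X - Y) x = cov X x - cov Y x := by
  have hY' : DiffFieldAt ((-1 : ℝ) • Y) x :=
    DiffFieldAt.smul (f := fun _ => -1) mdifferentiableAt_const hY
  have := cov_add cov hX hY'
  rw [cov_const_smul cov _ hY] at this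
  simpa [sub_eq_add_neg] using this

/-- Near a point, a smooth vector field agrees with a globally smooth one. -/
lemma SmoothNear.exists_global [T2Space M] {X : Field M} {x : M} (hX : SmoothNear X x) :
    ∃ Y : Field M, SmoothFieldOn Y Set.univ ∧ ∀ᶠ y in 𝓝 x, Y y = X y := by
  obtain ⟨U, hU, hUo, hxU⟩ := eventually_nhds_iff.1 hX
  obtain ⟨f, -, hf⟩ := ((SmoothBumpFunction.nhds_basis_tsupport (I := 𝓡 4) x).mem_iff).1
    (hUo.mem_nhds hxU)
  refine ⟨(f : M → ℝ) • X, ?_, ?_⟩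
  · refine ContMDiff.contMDiffOn ?_
    exact ContMDiffOn.smul_section_of_tsupport f.contMDiff.contMDiffOn hUo hf
      (fun y hy => (hU y hy).contMDiffWithinAt)
  · filter_upwards [f.eventuallyEq_one] with y hy
    simp [hy]

variable {cov}

/-- `∇X` is smooth, as a field of endomorphisms, near any point near which `X` is smooth. -/
lemma SmoothNear.smoothEndAt_cov [T2Space M]
    (hcov : CovariantDerivative.ContMDiffCovariantDerivative cov ∞)
    {X : Field M} {x : M} (hX : SmoothNear X x) : SmoothEndAt (cov X) x := by
  -- smoothness of a connection is expressed through globally smooth fields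
  obtain ⟨Y, hY, hYX⟩ := hX.exists_global
  have h1 := (hcov.contMDiff.contMDiff (σ := Y) hY) x (Set.mem_univ x)
  rw [contMDiffWithinAt_univ] at h1
  refine ContMDiffAt.congr_of_eventuallyEq h1 ?_
  filter_upwards [eventually_eventually_nhds.2 hYX, hX.eventually] with y hy hXy
  rw [cov_congr cov hXy.diffFieldAt (hy.mono fun _ h => h.symm)]

lemma SmoothNear.cov_apply [T2Space M]
    (hcov : CovariantDerivative.ContMDiffCovariantDerivative cov ∞)
    {X Y : Field M} {x : M} (hX : SmoothNear X x) (hY : SmoothNear Y x) :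
    SmoothNear (fun y => cov X y (Y y)) x := by
  filter_upwards [hX.eventually, hY] with y h1 h2 using (h1.smoothEndAt_cov hcov).apply_smooth h2

lemma SmoothNear.diff_cov [T2Space M]
    (hcov : CovariantDerivative.ContMDiffCovariantDerivative cov ∞)
    {X Y : Field M} {x : M} (hX : SmoothNear X x) (hY : DiffFieldAt Y x) :
    DiffFieldAt (fun y => cov X y (Y y)) x :=
  (hX.smoothEndAt_cov hcov).apply_diff hY

end Connection

/-! ### Metric compatibility and torsion -/

section Metric

variable [RiemannianBundle (fun x : M => TangentSpace (𝓡 4) x)]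

lemma IsAlmostHermitian.smoothEndAt
    {J : (x : M) → TangentSpace (𝓡 4) x →L[ℝ] TangentSpace (𝓡 4) x}
    (hJ : IsAlmostHermitian J) (x : M) : SmoothEndAt J x := hJ.smooth x

lemma IsAlmostHermitian.smoothNear
    {J : (x : M) → TangentSpace (𝓡 4) x →L[ℝ] TangentSpace (𝓡 4) x}
    (hJ : IsAlmostHermitian J) {X : Field M} {x : M} (hX : SmoothNear X x) :
    SmoothNear (fun y => J y (X y)) x := by
  filter_upwards [hX] with y hy using (hJ.smoothEndAt y).apply_smooth hy

variable [IsContMDiffRiemannianBundle (𝓡 4) ∞ (EuclideanSpace ℝ (Fin 4))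
  (fun x : M => TangentSpace (𝓡 4) x)]

/-- A smooth metric is in particular of class `C¹`. -/
lemma isContMDiffRiemannianBundle_one :
    IsContMDiffRiemannianBundle (𝓡 4) 1 (EuclideanSpace ℝ (Fin 4))
      (fun x : M => TangentSpace (𝓡 4) x) :=
  IsContMDiffRiemannianBundle.of_le (n := ∞) (by simp)

lemma SmoothFieldAt.inner {X Y : Field M} {x : M} (hX : SmoothFieldAt X x)
    (hY : SmoothFieldAt Y x) :
    ContMDiffAt (𝓡 4) 𝓘(ℝ, ℝ) ∞ (fun y => inner ℝ (X y) (Y y)) x :=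
  ContMDiffAt.inner_bundle (F := EuclideanSpace ℝ (Fin 4)) hX hY

lemma SmoothNear.inner {X Y : Field M} {x : M} (hX : SmoothNear X x) (hY : SmoothNear Y x) :
    SmoothFunNear (fun y => inner ℝ (X y) (Y y)) x := by
  filter_upwards [hX, hY] with y h1 h2 using h1.inner h2

lemma DiffFieldAt.inner {X Y : Field M} {x : M} (hX : DiffFieldAt X x) (hY : DiffFieldAt Y x) :
    MDifferentiableAt (𝓡 4) 𝓘(ℝ, ℝ) (fun y => inner ℝ (X y) (Y y)) x :=
  haveI := isContMDiffRiemannianBundle_one (M := M)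
  MDifferentiableAt.inner_bundle (F := EuclideanSpace ℝ (Fin 4)) (IB := 𝓡 4) hX hY

variable {cov : Connection M}

namespace IsLeviCivita

lemma dirDeriv_inner (hcov : IsLeviCivita cov) {X Y : Field M} {x : M} (hX : DiffFieldAt X x)
    (hY : DiffFieldAt Y x) (v : TangentSpace (𝓡 4) x) :
    dirDeriv (fun y => inner ℝ (X y) (Y y)) x v
      = inner ℝ (cov X x v) (Y x) + inner ℝ (X x) (cov Y x v) := by
  have := isContMDiffRiemannianBundle_one (M := M)
  have := hcov.metric.mvfderiv_inner_eq (ext v) hX hY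
  simpa [dirDeriv_eq] using this

lemma mlieBracket_eq (hcov : IsLeviCivita cov) {X Y : Field M} {x : M} (hX : DiffFieldAt X x)
    (hY : DiffFieldAt Y x) :
    VectorField.mlieBracket (𝓡 4) X Y x = cov Y x (X x) - cov X x (Y x) :=
  ((CovariantDerivative.torsion_eq_zero_iff cov).1 hcov.torsionFree hX hY).symm

end IsLeviCivita

end Metric

/-! ### The curvature tensor -/

lemma SmoothNear.mlieBracket {X Y : Field M} {x : M} (hX : SmoothNear X x) (hY : SmoothNear Y x) :
    SmoothNear (VectorField.mlieBracket (𝓡 4) X Y) x := by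
  have : IsManifold (𝓡 4) (((⊤ : ℕ∞) : ℕ∞ω) + 1) M := ‹IsManifold (𝓡 4) ∞ M›
  have : IsManifold (𝓡 4) (minSmoothness ℝ 2) M := by
    simp only [minSmoothness_of_isRCLikeNormedField]
    infer_instance
  filter_upwards [hX, hY] with y h1 h2
  exact ContMDiffAt.mlieBracket_vectorField (m := ⊤) (n := ⊤) h1 h2
    (by simp only [minSmoothness_of_isRCLikeNormedField]; exact le_rfl)

lemma SmoothNear.leibniz_mlieBracket {X Y Z : Field M} {x : M} (hX : SmoothNear X x)
    (hY : SmoothNear Y x) (hZ : SmoothNear Z x) :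
    VectorField.mlieBracket (𝓡 4) X (VectorField.mlieBracket (𝓡 4) Y Z) x =
      VectorField.mlieBracket (𝓡 4) (VectorField.mlieBracket (𝓡 4) X Y) Z x
        + VectorField.mlieBracket (𝓡 4) Y (VectorField.mlieBracket (𝓡 4) X Z) x := by
  have hM : IsManifold (𝓡 4) (minSmoothness ℝ 3) M := by
    simp only [minSmoothness_of_isRCLikeNormedField]
    infer_instance
  have h2 : ∀ {W : Field M}, SmoothNear W x → ContMDiffAt (𝓡 4)
      ((𝓡 4).prod 𝓘(ℝ, EuclideanSpace ℝ (Fin 4))) (minSmoothness ℝ 2)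
      (fun y => TotalSpace.mk' (EuclideanSpace ℝ (Fin 4)) (E := fun y : M => TangentSpace (𝓡 4) y)
      y (W y)) x := by
    intro W hW
    simp only [minSmoothness_of_isRCLikeNormedField]
    exact ContMDiffAt.of_le hW.smoothFieldAt ENat.LEInfty.out
  exact VectorField.leibniz_identity_mlieBracket_apply (h2 hX) (h2 hY) (h2 hZ)

/-- The Lie bracket of vector fields is the commutator of the associated derivations. It follows
from the Jacobi identity for `X`, `Y` and `f Z`, with `Z` any field that does not vanish at the
point. -/
lemma dirDeriv_mlieBracket {f : M → ℝ} {X Y : Field M} {x : M} (hf : SmoothFunNear f x)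
    (hX : SmoothNear X x) (hY : SmoothNear Y x)
    (hXf : MDifferentiableAt (𝓡 4) 𝓘(ℝ, ℝ) (fun y => dirDeriv f y (X y)) x)
    (hYf : MDifferentiableAt (𝓡 4) 𝓘(ℝ, ℝ) (fun y => dirDeriv f y (Y y)) x) :
    dirDeriv f x (VectorField.mlieBracket (𝓡 4) X Y x)
      = dirDeriv (fun y => dirDeriv f y (Y y)) x (X x)
        - dirDeriv (fun y => dirDeriv f y (X y)) x (Y x) := by
  obtain ⟨v, hv⟩ : ∃ v : TangentSpace (𝓡 4) x, v ≠ 0 :=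
    exists_ne (α := EuclideanSpace ℝ (Fin 4)) 0
  set Z : Field M := ext v with hZdef
  have hZ : SmoothNear Z x := smoothNear_ext v
  have key : ∀ {A B : Field M}, SmoothNear A x → SmoothNear B x →
      MDifferentiableAt (𝓡 4) 𝓘(ℝ, ℝ) (fun y => dirDeriv f y (B y)) x →
      VectorField.mlieBracket (𝓡 4) A (VectorField.mlieBracket (𝓡 4) B (f • Z)) x =
        (dirDeriv (fun y => dirDeriv f y (B y)) x (A x) • Z x
          + dirDeriv f x (B x) • VectorField.mlieBracket (𝓡 4) A Z x)
        + (dirDeriv f x (A x) • VectorField.mlieBracket (𝓡 4) B Z x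
          + f x • VectorField.mlieBracket (𝓡 4) A (VectorField.mlieBracket (𝓡 4) B Z) x) := by
    intro A B hA hB hBf
    have e : VectorField.mlieBracket (𝓡 4) B (f • Z) =ᶠ[𝓝 x]
        ((fun y => dirDeriv f y (B y)) • Z + f • VectorField.mlieBracket (𝓡 4) B Z : Field M) := by
      filter_upwards [hf, hZ] with y h1 h2
      exact VectorField.mlieBracket_smul_right (h1.mdifferentiableAt (by simp)) h2.diffFieldAt
    have hBZ : DiffFieldAt (VectorField.mlieBracket (𝓡 4) B Z) x := (hB.mlieBracket hZ).diffFieldAt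
    rw [Filter.EventuallyEq.mlieBracket_vectorField_eq (Filter.EventuallyEq.refl _ A) e]
    rw [VectorField.mlieBracket_add_right (hZ.diffFieldAt.smul hBf) (hBZ.smul hf.mdiffAt),
      VectorField.mlieBracket_smul_right hBf hZ.diffFieldAt,
      VectorField.mlieBracket_smul_right hf.mdiffAt hBZ]
    rfl
  have J1 := hX.leibniz_mlieBracket hY (hZ.smul hf)
  have J2 := hX.leibniz_mlieBracket hY hZ
  have h3 := VectorField.mlieBracket_smul_right (V := VectorField.mlieBracket (𝓡 4) X Y)
    hf.mdiffAt hZ.diffFieldAt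
  rw [← dirDeriv_eq] at h3
  rw [key hX hY hYf, key hY hX hXf, h3, J2] at J1
  have h4 : (dirDeriv f x (VectorField.mlieBracket (𝓡 4) X Y x)
      - (dirDeriv (fun y => dirDeriv f y (Y y)) x (X x)
        - dirDeriv (fun y => dirDeriv f y (X y)) x (Y x))) • Z x = 0 := by
    simp only [sub_smul]
    rw [← sub_eq_zero] at J1
    rw [← neg_eq_zero, ← J1, smul_add]
    abel
  rw [hZdef, ext_self, smul_eq_zero] at h4
  exact sub_eq_zero.1 (h4.resolve_right hv)

section Curvature

variable [T2Space M] {cov : Connection M}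

lemma curvField_swap (X Y Z : Field M) (x : M) :
    curvField cov X Y Z x = - curvField cov Y X Z x := by
  unfold curvField
  rw [VectorField.mlieBracket_swap_apply (V := X), map_neg]
  abel

lemma tensorialAt_curvField (hcov : CovariantDerivative.ContMDiffCovariantDerivative cov ∞)
    (Y : Field M) {Z : Field M} {x : M} (hZ : SmoothNear Z x) :
    TensorialAt (𝓡 4) (EuclideanSpace ℝ (Fin 4)) (fun X : Field M => curvField cov X Y Z x) x where
  smul {f X} hf hX := by
    have h1 : (fun y => cov Z y ((f • X) y)) = f • (fun y => cov Z y (X y)) := by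
      ext1 y; simp
    have h2 := cov_smul cov hf (hZ.diff_cov hcov hX) (Y x)
    have h3 := VectorField.mlieBracket_smul_left (W := Y) hf hX
    rw [← dirDeriv_eq] at h3
    simp only [curvField]
    rw [h1, h2, h3]
    simp only [Pi.smul_apply', map_add, map_smul, map_neg, neg_smul]
    module
  add {X X'} hX hX' := by
    have h1 : (fun y => cov Z y ((X + X') y))
        = (fun y => cov Z y (X y)) + (fun y => cov Z y (X' y)) := by
      ext1 y; simp
    have h2 := cov_add cov (hZ.diff_cov hcov hX) (hZ.diff_cov hcov hX')
    have h3 := VectorField.mlieBracket_add_left (W := Y) hX hX'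
    simp only [curvField]
    rw [h1, h2, h3]
    simp only [Pi.add_apply, map_add, add_apply]
    abel

variable [RiemannianBundle (fun x : M => TangentSpace (𝓡 4) x)]
  [IsContMDiffRiemannianBundle (𝓡 4) ∞ (EuclideanSpace ℝ (Fin 4))
  (fun x : M => TangentSpace (𝓡 4) x)]

namespace IsLeviCivita

/-- `R(X,Y)` is skew: apply `[X,Y] = XY - YX` to the function `⟨Z, W⟩`. -/
lemma inner_curvField (hcov : IsLeviCivita cov) {X Y Z W : Field M} {x : M} (hX : SmoothNear X x)
    (hY : SmoothNear Y x) (hZ : SmoothNear Z x) (hW : SmoothNear W x) :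
    inner ℝ (curvField cov X Y Z x) (W x) = - inner ℝ (Z x) (curvField cov X Y W x) := by
  have hf := hZ.inner hW
  have e : ∀ {B : Field M}, SmoothNear B x → ∀ᶠ y in 𝓝 x,
      dirDeriv (fun y => inner ℝ (Z y) (W y)) y (B y)
        = inner ℝ (cov Z y (B y)) (W y) + inner ℝ (Z y) (cov W y (B y)) := by
    intro B hB
    filter_upwards [hZ, hW] with y h1 h2
    exact hcov.dirDeriv_inner h1.diffFieldAt h2.diffFieldAt _
  have hd1 : ∀ {B : Field M}, SmoothNear B x → MDifferentiableAt (𝓡 4) 𝓘(ℝ, ℝ)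
      (fun y => inner ℝ (cov Z y (B y)) (W y)) x := fun hB =>
    ((hZ.cov_apply hcov.smooth hB).diffFieldAt).inner hW.diffFieldAt
  have hd2 : ∀ {B : Field M}, SmoothNear B x → MDifferentiableAt (𝓡 4) 𝓘(ℝ, ℝ)
      (fun y => inner ℝ (Z y) (cov W y (B y))) x := fun hB =>
    (hZ.diffFieldAt).inner (hW.cov_apply hcov.smooth hB).diffFieldAt
  have hd : ∀ {B : Field M}, SmoothNear B x → MDifferentiableAt (𝓡 4) 𝓘(ℝ, ℝ)
      (fun y => dirDeriv (fun y => inner ℝ (Z y) (W y)) y (B y)) x := fun hB =>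
    ((hd1 hB).add (hd2 hB)).congr_of_eventuallyEq (e hB)
  have h2 : ∀ {A B : Field M}, SmoothNear A x → SmoothNear B x →
      dirDeriv (fun y => dirDeriv (fun y => inner ℝ (Z y) (W y)) y (B y)) x (A x) =
        (inner ℝ (cov (fun y => cov Z y (B y)) x (A x)) (W x)
          + inner ℝ (cov Z x (B x)) (cov W x (A x)))
        + (inner ℝ (cov Z x (A x)) (cov W x (B x))
          + inner ℝ (Z x) (cov (fun y => cov W y (B y)) x (A x))) := by
    intro A B hA hB
    rw [dirDeriv_congr (e hB), dirDeriv_add (hd1 hB) (hd2 hB),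
      hcov.dirDeriv_inner (hZ.cov_apply hcov.smooth hB).diffFieldAt hW.diffFieldAt,
      hcov.dirDeriv_inner hZ.diffFieldAt (hW.cov_apply hcov.smooth hB).diffFieldAt]
  have main := dirDeriv_mlieBracket hf hX hY (hd hX) (hd hY)
  rw [h2 hX hY, h2 hY hX, hcov.dirDeriv_inner hZ.diffFieldAt hW.diffFieldAt] at main
  simp only [curvField, inner_sub_left, inner_sub_right]
  linarith

/-- Without torsion, the first Bianchi identity is the Jacobi identity. -/
lemma bianchi_curvField (hcov : IsLeviCivita cov) {X Y Z : Field M} {x : M} (hX : SmoothNear X x)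
    (hY : SmoothNear Y x) (hZ : SmoothNear Z x) :
    curvField cov X Y Z x + curvField cov Y Z X x + curvField cov Z X Y x = 0 := by
  have key : ∀ {A B C : Field M}, SmoothNear A x → SmoothNear B x → SmoothNear C x →
      VectorField.mlieBracket (𝓡 4) A (VectorField.mlieBracket (𝓡 4) B C) x =
      cov (fun y => cov C y (B y)) x (A x) - cov (fun y => cov B y (C y)) x (A x)
        - cov A x (VectorField.mlieBracket (𝓡 4) B C x) := by
    intro A B C hA hB hC
    have hBC : DiffFieldAt (VectorField.mlieBracket (𝓡 4) B C) x := (hB.mlieBracket hC).diffFieldAt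
    have e : ∀ᶠ y in 𝓝 x, VectorField.mlieBracket (𝓡 4) B C y =
        ((fun y => cov C y (B y)) - (fun y => cov B y (C y)) : Field M) y := by
      filter_upwards [hB, hC] with y h1 h2
      exact hcov.mlieBracket_eq h1.diffFieldAt h2.diffFieldAt
    rw [hcov.mlieBracket_eq hA.diffFieldAt hBC, cov_congr cov hBC e,
      cov_sub cov (hC.cov_apply hcov.smooth hB).diffFieldAt
        (hB.cov_apply hcov.smooth hC).diffFieldAt]
    simp
  have J := hX.leibniz_mlieBracket hY hZ
  rw [VectorField.mlieBracket_swap_apply (V := VectorField.mlieBracket (𝓡 4) X Y),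
    key hX hY hZ, key hZ hX hY, key hY hX hZ,
    VectorField.mlieBracket_swap_apply (V := X) (W := Z), map_neg] at J
  rw [← sub_eq_zero] at J
  rw [← J]
  simp only [curvField]
  abel

/-- The curvature tensor at `x` can be computed with any smooth extensions of the vectors. In the
third argument this follows from skew-symmetry. -/
lemma R_eq (hcov : IsLeviCivita cov) {X Y Z : Field M} {x : M} (hX : SmoothNear X x)
    (hY : SmoothNear Y x) (hZ : SmoothNear Z x) :
    R cov x (X x) (Y x) (Z x) = curvField cov X Y Z x := by
  have e1 := (tensorialAt_curvField hcov.smooth Y hZ).pointwise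
    (smoothNear_ext (X x)).diffFieldAt hX.diffFieldAt (ext_self _)
  have e2 := (tensorialAt_curvField hcov.smooth (ext (X x)) hZ).pointwise
    (smoothNear_ext (Y x)).diffFieldAt hY.diffFieldAt (ext_self _)
  rw [← e1, curvField_swap, ← e2, ← curvField_swap]
  refine ext_inner_right ℝ fun w => ?_
  have h := hcov.inner_curvField (smoothNear_ext (X x)) (smoothNear_ext (Y x))
    (smoothNear_ext (Z x)) (smoothNear_ext w)
  have h' := hcov.inner_curvField (smoothNear_ext (X x)) (smoothNear_ext (Y x))
    hZ (smoothNear_ext w)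
  simp only [ext_self] at h h'
  rw [R, h, h']

lemma R_swap (x : M) (u v w : TangentSpace (𝓡 4) x) : R cov x u v w = - R cov x v u w :=
  curvField_swap _ _ _ _

lemma R_skew (hcov : IsLeviCivita cov) (x : M) (u v w z : TangentSpace (𝓡 4) x) :
    inner ℝ (R cov x u v w) z = - inner ℝ (R cov x u v z) w := by
  have h := hcov.inner_curvField (smoothNear_ext u) (smoothNear_ext v)
    (smoothNear_ext w) (smoothNear_ext z)
  simp only [ext_self] at h
  rw [R, h, real_inner_comm, R]

lemma R_bianchi (hcov : IsLeviCivita cov) (x : M) (u v w : TangentSpace (𝓡 4) x) :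
    R cov x u v w + R cov x v w u + R cov x w u v = 0 :=
  hcov.bianchi_curvField (smoothNear_ext u) (smoothNear_ext v) (smoothNear_ext w)

/-- The curvature tensor as a trilinear map. -/
def curvTensor (hcov : IsLeviCivita cov) (x : M) :
    TangentSpace (𝓡 4) x →ₗ[ℝ] TangentSpace (𝓡 4) x →ₗ[ℝ] TangentSpace (𝓡 4) x →ₗ[ℝ]
      TangentSpace (𝓡 4) x :=
  have add₁ : ∀ u u' v w, R cov x (u + u') v w = R cov x u v w + R cov x u' v w := fun u u' v w =>
    map_add (TensorialAt.mkHom _ x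
      (tensorialAt_curvField hcov.smooth (ext v) (smoothNear_ext w))) u u'
  have smul₁ : ∀ (c : ℝ) u v w, R cov x (c • u) v w = c • R cov x u v w := fun c u v w =>
    map_smul (TensorialAt.mkHom _ x
      (tensorialAt_curvField hcov.smooth (ext v) (smoothNear_ext w))) c u
  have add₃ : ∀ u v w w', R cov x u v (w + w') = R cov x u v w + R cov x u v w' :=
    fun u v w w' => ext_inner_right ℝ fun z => by
      rw [inner_add_left, hcov.R_skew, hcov.R_skew x u v w, hcov.R_skew x u v w', inner_add_right]
      ring
  have smul₃ : ∀ (c : ℝ) u v w, R cov x u v (c • w) = c • R cov x u v w :=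
    fun c u v w => ext_inner_right ℝ fun z => by
      rw [inner_smul_left, hcov.R_skew, hcov.R_skew x u v w, inner_smul_right]
      simp
  LinearMap.mk₂ ℝ (fun u v =>
      { toFun := R cov x u v, map_add' := add₃ u v, map_smul' := fun c => smul₃ c u v })
    (fun u u' v => LinearMap.ext fun w => add₁ u u' v w)
    (fun c u v => LinearMap.ext fun w => smul₁ c u v w)
    (fun u v v' => LinearMap.ext fun w => by
      change R cov x u (v + v') w = R cov x u v w + R cov x u v' w
      rw [R_swap, add₁, R_swap x v, R_swap x v']; abel)
    (fun c u v => LinearMap.ext fun w => by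
      change R cov x u (c • v) w = c • R cov x u v w
      rw [R_swap, smul₁, R_swap x v]; simp)

@[simp] lemma curvTensor_apply (hcov : IsLeviCivita cov) (x : M) (u v w : TangentSpace (𝓡 4) x) :
    hcov.curvTensor x u v w = R cov x u v w := rfl

end IsLeviCivita

end Curvature

/-! ### Kähler curvature tensors on a four-dimensional inner product space -/

section Algebra

variable {V : Type*} [NormedAddCommGroup V] [InnerProductSpace ℝ V]

/-- The trace of a bilinear form does not depend on the orthonormal basis. -/
lemma sum_orthonormalBasis_eq {ι κ : Type*} [Fintype ι] [Fintype κ] (b : OrthonormalBasis ι ℝ V)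
    (c : OrthonormalBasis κ ℝ V) (B : V →ₗ[ℝ] V →ₗ[ℝ] ℝ) :
    ∑ i, B (b i) (b i) = ∑ k, B (c k) (c k) := by
  have h1 : ∀ i, B (b i) (b i) = ∑ k, ∑ l,
      (inner ℝ (c k) (b i) * inner ℝ (b i) (c l)) * B (c l) (c k) := by
    intro i
    conv_lhs => rw [← c.sum_repr' (b i)]
    simp only [map_sum, map_smul, LinearMap.sum_apply, LinearMap.smul_apply, smul_eq_mul,
      Finset.mul_sum]
    refine Finset.sum_congr rfl fun k _ => Finset.sum_congr rfl fun l _ => ?_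
    rw [real_inner_comm (b i) (c l)]
    ring
  classical
  simp only [h1]
  rw [Finset.sum_comm]
  refine Finset.sum_congr rfl fun k _ => ?_
  rw [Finset.sum_comm]
  simp only [← Finset.sum_mul, b.sum_inner_mul_inner, orthonormal_iff_ite.1 c.orthonormal]
  simp

lemma _root_.OrthonormalBasis.inner_of_eq (e : OrthonormalBasis (Fin 4) ℝ V) {v : V} {a b c d : ℝ}
    (hv : v = a • e 0 + b • e 1 + c • e 2 + d • e 3) :
    inner ℝ (e 0) v = a ∧ inner ℝ (e 1) v = b ∧ inner ℝ (e 2) v = c ∧ inner ℝ (e 3) v = d := by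
  have o := orthonormal_iff_ite.1 e.orthonormal
  subst hv
  refine ⟨?_, ?_, ?_, ?_⟩ <;> simp [inner_add_right, inner_smul_right, o]

/-- `Rt` has the algebraic symmetries of the curvature tensor `R(u,v)w` of a Kähler metric with
complex structure `Jb`. -/
structure IsKahlerCurvature (Rt : V →ₗ[ℝ] V →ₗ[ℝ] V →ₗ[ℝ] V) (Jb : V →ₗ[ℝ] V) : Prop where
  swap : ∀ u v w, Rt u v w = - Rt v u w
  skew : ∀ u v w z, inner ℝ (Rt u v w) z = - inner ℝ (Rt u v z) w
  bianchi : ∀ u v w, Rt u v w + Rt v w u + Rt w u v = 0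
  sq : ∀ v, Jb (Jb v) = - v
  isometry : ∀ u v, inner ℝ (Jb u) (Jb v) = inner ℝ u v
  comm : ∀ u v w, Rt u v (Jb w) = Jb (Rt u v w)

namespace IsKahlerCurvature

variable {Rt : V →ₗ[ℝ] V →ₗ[ℝ] V →ₗ[ℝ] V} {Jb : V →ₗ[ℝ] V}

lemma pair (h : IsKahlerCurvature Rt Jb) (u v w z : V) :
    inner ℝ (Rt u v w) z = inner ℝ (Rt w z u) v := by
  have b : ∀ a b c d, inner ℝ (Rt a b c) d + inner ℝ (Rt b c a) d + inner ℝ (Rt c a b) d = 0 := by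
    intro a b c d
    rw [← inner_add_left, ← inner_add_left, h.bianchi, inner_zero_left]
  have s : ∀ a b c d, inner ℝ (Rt a b c) d = - inner ℝ (Rt b a c) d := by
    intro a b c d
    rw [h.swap, inner_neg_left]
  have := b u v w z
  have := b v w z u
  have := b w z u v
  have := b z u v w
  have k := h.skew
  linarith [k u v w z, k v w u z, k w u v z, k v w z u, k w z v u, k z v w u, k w z u v,
    k z u w v, k u w z v, k z u v w, k u v z w, k v z u w, s u v w z, s v w u z, s w u v z,
    s v w z u, s w z v u, s z v w u, s w z u v, s z u w v, s u w z v, s z u v w, s u v z w,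
    s v z u w]

lemma map_map (h : IsKahlerCurvature Rt Jb) (u v w : V) : Rt (Jb u) (Jb v) w = Rt u v w := by
  refine ext_inner_right ℝ fun z => ?_
  rw [h.pair, h.comm, h.isometry, ← h.pair]

lemma apply_self (h : IsKahlerCurvature Rt Jb) (u w : V) : Rt u u w = 0 := by
  have h1 : (2 : ℝ) • Rt u u w = 0 := by
    rw [two_smul]
    nth_rewrite 1 [h.swap u u w]
    simp
  simpa using h1

lemma isometry_left (h : IsKahlerCurvature Rt Jb) (u v : V) :
    inner ℝ (Jb u) v = - inner ℝ u (Jb v) := by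
  rw [← h.isometry u, h.sq, inner_neg_right, neg_neg]

lemma inner_self (h : IsKahlerCurvature Rt Jb) (u : V) : inner ℝ u (Jb u) = 0 := by
  have := h.isometry_left u u
  rw [real_inner_comm] at this
  linarith

/-- The nullity space of a Kähler curvature tensor is invariant under the complex structure. -/
lemma nullity_map (h : IsKahlerCurvature Rt Jb) {n : V} (hn : ∀ v w, Rt n v w = 0) (v w : V) :
    Rt (Jb n) v w = 0 := by
  have := h.map_map n (-(Jb v)) w
  rw [map_neg, h.sq, neg_neg] at this
  rw [this, hn]

/-- If the curvature tensor has nullity, it is a multiple of `ω ⊗ ω` with `ω = p ∧ Jb p` for a unit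
vector `p`: complete a unit nullity vector `n` to an orthonormal basis `n, Jb n, p, Jb p`. -/
lemma exists_of_nullity (h : IsKahlerCurvature Rt Jb) (hdim : Module.finrank ℝ V = 4) {n : V}
    (hn0 : n ≠ 0) (hn : ∀ v w, Rt n v w = 0) :
    ∃ (f : OrthonormalBasis (Fin 4) ℝ V) (K : ℝ), f 3 = Jb (f 2) ∧ ∀ u v w z,
      inner ℝ (Rt u v w) z = K *
        ((inner ℝ (f 2) u * inner ℝ (f 3) v - inner ℝ (f 3) u * inner ℝ (f 2) v) *
        (inner ℝ (f 2) w * inner ℝ (f 3) z - inner ℝ (f 3) w * inner ℝ (f 2) z)) := by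
  have : FiniteDimensional ℝ V := FiniteDimensional.of_finrank_eq_succ hdim
  set m : V := ‖n‖⁻¹ • n with hm
  have hm1 : ‖m‖ = 1 := by
    rw [hm, norm_smul, norm_inv, norm_norm, inv_mul_cancel₀ (norm_ne_zero_iff.2 hn0)]
  have hmn : ∀ v w, Rt m v w = 0 := fun v w => by simp [hm, hn]
  have hnorm : ∀ v, ‖Jb v‖ = ‖v‖ := fun v => by
    rw [@norm_eq_sqrt_real_inner V, @norm_eq_sqrt_real_inner V, h.isometry]
  obtain ⟨p, hp1, hmp, hJp⟩ : ∃ p : V, ‖p‖ = 1 ∧ inner ℝ m p = 0 ∧ inner ℝ (Jb m) p = 0 := by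
    set S : Submodule ℝ V := Submodule.span ℝ {m, Jb m} with hS
    have hS2 : Module.finrank ℝ S ≤ 2 := by
      classical
      have := finrank_span_finset_le_card (R := ℝ) ({m, Jb m} : Finset V)
      simp only [Finset.coe_insert, Finset.coe_singleton] at this
      exact this.trans Finset.card_le_two
    have hSne : Sᗮ ≠ ⊥ := by
      intro hbot
      have := S.finrank_add_finrank_orthogonal
      rw [hbot, finrank_bot, hdim] at this
      omega
    obtain ⟨q, hq, hq0⟩ := Submodule.exists_mem_ne_zero_of_ne_bot hSne
    have hmS : m ∈ S := Submodule.subset_span (by simp)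
    have hJS : Jb m ∈ S := Submodule.subset_span (by simp)
    refine ⟨‖q‖⁻¹ • q, ?_, ?_, ?_⟩
    · rw [norm_smul, norm_inv, norm_norm, inv_mul_cancel₀ (norm_ne_zero_iff.2 hq0)]
    · rw [inner_smul_right, Submodule.inner_right_of_mem_orthogonal hmS hq, mul_zero]
    · rw [inner_smul_right, Submodule.inner_right_of_mem_orthogonal hJS hq, mul_zero]
  have hmJp : inner ℝ m (Jb p) = 0 := by
    have := h.isometry_left m p
    linarith
  have horth : Orthonormal ℝ ![m, Jb m, p, Jb p] := by
    rw [orthonormal_iff_ite]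
    intro i j
    fin_cases i <;> fin_cases j <;>
      simp [h.isometry, hmp, hJp, hmJp, hm1, hp1, hnorm, h.inner_self,
        real_inner_comm m, real_inner_comm (Jb m) p,
        real_inner_comm p (Jb p)]
  set f : OrthonormalBasis (Fin 4) ℝ V :=
    (basisOfOrthonormalOfCardEqFinrank horth (by simp [hdim])).toOrthonormalBasis
      (by simpa using horth) with hf
  have hfc : ∀ i, f i = ![m, Jb m, p, Jb p] i := fun i => by simp [hf]
  have f0 : f 0 = m := hfc 0
  have f1 : f 1 = Jb m := hfc 1
  have f2 : f 2 = p := hfc 2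
  have f3 : f 3 = Jb p := hfc 3
  have z0 : ∀ v w, Rt (f 0) v w = 0 := fun v w => by rw [f0, hmn]
  have z1 : ∀ v w, Rt (f 1) v w = 0 := fun v w => by rw [f1, h.nullity_map hmn]
  have z0' : ∀ v w, Rt v (f 0) w = 0 := fun v w => by rw [h.swap, z0, neg_zero]
  have z1' : ∀ v w, Rt v (f 1) w = 0 := fun v w => by rw [h.swap, z1, neg_zero]
  have hR : ∀ u v w, Rt u v w =
      (inner ℝ (f 2) u * inner ℝ (f 3) v - inner ℝ (f 3) u * inner ℝ (f 2) v) •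
        Rt (f 2) (f 3) w := by
    intro u v w
    conv_lhs => rw [← f.sum_repr' u, ← f.sum_repr' v]
    simp only [Fin.sum_univ_four, map_add, map_smul, LinearMap.add_apply, LinearMap.smul_apply,
      z0, z1, z0', z1', h.apply_self, h.swap (f 3) (f 2)]
    module
  refine ⟨f, inner ℝ (Rt (f 2) (f 3) (f 2)) (f 3), by rw [f3, f2], fun u v w z => ?_⟩
  rw [hR u v w, inner_smul_left, h.pair (f 2), hR w z, inner_smul_left]
  simp only [conj_trivial]
  ring

end IsKahlerCurvature

/-- `e` is an orthonormal basis adapted to the complex structure `Jb`: `Jb e₀ = e₁` and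
`Jb e₂ = -e₃`. The sign makes `e` compatible with a standard frame, in which `J e₂ = e₃`. -/
structure IsAdapted (Jb : V →ₗ[ℝ] V) (e : OrthonormalBasis (Fin 4) ℝ V) : Prop where
  map_zero : Jb (e 0) = e 1
  map_two : Jb (e 2) = - e 3

namespace IsKahlerCurvature

variable {Rt : V →ₗ[ℝ] V →ₗ[ℝ] V →ₗ[ℝ] V} {Jb : V →ₗ[ℝ] V} {e : OrthonormalBasis (Fin 4) ℝ V}

/-- If the curvature has nullity and the Ricci form is invariant under the second complex structure
`J`, then either the curvature vanishes or the plane carrying it is one of the two eigenplanes of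
`J Jb`. Hence the mixed curvature components vanish. -/
lemma mixed_eq_zero_of_nullity (h : IsKahlerCurvature Rt Jb) (hdim : Module.finrank ℝ V = 4) {n : V}
    (hn0 : n ≠ 0) (hn : ∀ v w, Rt n v w = 0) (he : IsAdapted Jb e) {J : V →ₗ[ℝ] V}
    (hJ0 : J (e 0) = e 1) (hJ2 : J (e 2) = e 3) (hJsq : ∀ v, J (J v) = - v)
    (hJi : ∀ u v, inner ℝ (J u) (J v) = inner ℝ u v)
    {ι : Type*} [Fintype ι] (b : OrthonormalBasis ι ℝ V)
    (hric : ∀ u v, ∑ i, inner ℝ (Rt (b i) (J u) (J v)) (b i) = ∑ i, inner ℝ (Rt (b i) u v) (b i)) :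
    inner ℝ (Rt (e 1) (e 3) (e 0)) (e 2) = 0 := by
  obtain ⟨f, K, hf3, hR⟩ := h.exists_of_nullity hdim hn0 hn
  have hJl : ∀ u v, inner ℝ u (J v) = - inner ℝ (J u) v := fun u v => by
    rw [← hJi u (J v), hJsq, inner_neg_right]
  have hJbl : ∀ u v, inner ℝ u (Jb v) = - inner ℝ (Jb u) v := fun u v => by
    rw [h.isometry_left, neg_neg]
  have ric : ∀ u v, ∑ i, inner ℝ (Rt (b i) u v) (b i)
      = - K * (inner ℝ (f 2) u * inner ℝ (f 2) v + inner ℝ (f 3) u * inner ℝ (f 3) v) := by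
    intro u v
    have := sum_orthonormalBasis_eq b f
      (LinearMap.mk₂ ℝ (fun z z' => inner ℝ (Rt z u v) z') (by simp [inner_add_left])
        (by simp [inner_smul_left]) (by simp [inner_add_right]) (by simp [inner_smul_right]))
    simp only [LinearMap.mk₂_apply] at this
    rw [this]
    simp only [Fin.sum_univ_four, hR]
    have o := orthonormal_iff_ite.1 f.orthonormal
    simp only [o]
    simp
    ring
  have hp : inner ℝ (f 2) (J (f 2)) = 0 := by
    have := hJl (f 2) (f 2)
    linarith [real_inner_comm (f 2) (J (f 2))]
  have key : K * (1 - inner ℝ (f 3) (J (f 2)) ^ 2) = 0 := by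
    have := hric (f 2) (f 2)
    rw [ric, ric, hp] at this
    have o := orthonormal_iff_ite.1 f.orthonormal
    simp only [o] at this
    simp at this
    linarith
  rw [hR]
  rcases mul_eq_zero.1 key with hK | hK
  · rw [hK, zero_mul]
  have c1 : Jb (e 1) = - e 0 := by rw [← he.map_zero, h.sq]
  have c3 : Jb (e 3) = e 2 := by rw [← neg_eq_iff_eq_neg.2 he.map_two, map_neg, h.sq, neg_neg]
  have d1 : J (e 1) = - e 0 := by rw [← hJ0, hJsq]
  have d3 : J (e 3) = - e 2 := by rw [← hJ2, hJsq]
  have q : ∀ v, inner ℝ (f 3) v = - inner ℝ (f 2) (Jb v) := fun v => by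
    rw [hf3, h.isometry_left]
  have r : ∀ v, inner ℝ v (J (f 2)) = - inner ℝ (f 2) (J v) := fun v => by
    rw [hJl, real_inner_comm]
  have q0 : inner ℝ (f 3) (e 0) = - inner ℝ (f 2) (e 1) := by rw [q, he.map_zero]
  have q1 : inner ℝ (f 3) (e 1) = inner ℝ (f 2) (e 0) := by rw [q, c1, inner_neg_right, neg_neg]
  have q2 : inner ℝ (f 3) (e 2) = inner ℝ (f 2) (e 3) := by
    rw [q, he.map_two, inner_neg_right, neg_neg]
  have q3 : inner ℝ (f 3) (e 3) = - inner ℝ (f 2) (e 2) := by rw [q, c3]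
  have r0 : inner ℝ (e 0) (J (f 2)) = - inner ℝ (f 2) (e 1) := by rw [r, hJ0]
  have r1 : inner ℝ (e 1) (J (f 2)) = inner ℝ (f 2) (e 0) := by rw [r, d1, inner_neg_right, neg_neg]
  have r2 : inner ℝ (e 2) (J (f 2)) = - inner ℝ (f 2) (e 3) := by rw [r, hJ2]
  have r3 : inner ℝ (e 3) (J (f 2)) = inner ℝ (f 2) (e 2) := by rw [r, d3, inner_neg_right, neg_neg]
  have hsum : inner ℝ (f 2) (f 2) = ∑ i, inner ℝ (f 2) (e i) * inner ℝ (e i) (f 2) :=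
    (e.sum_inner_mul_inner _ _).symm
  have hsum' : inner ℝ (f 3) (J (f 2)) = ∑ i, inner ℝ (f 3) (e i) * inner ℝ (e i) (J (f 2)) :=
    (e.sum_inner_mul_inner _ _).symm
  simp only [Fin.sum_univ_four, q0, q1, q2, q3, r0, r1, r2, r3] at hsum'
  simp only [Fin.sum_univ_four, real_inner_comm (f 2), real_inner_self_eq_norm_sq,
    f.norm_eq_one] at hsum
  rw [hsum'] at hK
  rw [q0, q2]
  generalize inner ℝ (f 2) (e 0) = p0 at *
  generalize inner ℝ (f 2) (e 1) = p1 at *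
  generalize inner ℝ (f 2) (e 2) = p2 at *
  generalize inner ℝ (f 2) (e 3) = p3 at *
  -- `|f₂|² = 1` and `⟨f₃, J f₂⟩ = (p0² + p1²) - (p2² + p3²) = ±1`
  have hprod : (p0 ^ 2 + p1 ^ 2) * (p2 ^ 2 + p3 ^ 2) = 0 := by
    linear_combination -(1 + (p0 * p0 + p1 * p1 + p2 * p2 + p3 * p3)) / 4 * hsum + 1 / 4 * hK
  have hzero : ∀ a b : ℝ, a ^ 2 + b ^ 2 = 0 → a = 0 ∧ b = 0 := fun a b hab =>
    ⟨pow_eq_zero_iff two_ne_zero |>.1 (by linarith only [hab, sq_nonneg a, sq_nonneg b]),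
      pow_eq_zero_iff two_ne_zero |>.1 (by linarith only [hab, sq_nonneg a, sq_nonneg b])⟩
  have hz : p0 * p3 + p1 * p2 = 0 := by
    rcases mul_eq_zero.1 hprod with hh | hh <;> simp [hzero _ _ hh]
  have : p0 * p3 - -p1 * p2 = 0 := by linarith only [hz]
  rw [this]
  ring

lemma apply_combination (h : IsKahlerCurvature Rt Jb) (x₀ x₁ x₂ x₃ w : V)
    (a₀ a₁ a₂ a₃ b₀ b₁ b₂ b₃ : ℝ) :
    Rt (a₀ • x₀ + a₁ • x₁ + a₂ • x₂ + a₃ • x₃) (b₀ • x₀ + b₁ • x₁ + b₂ • x₂ + b₃ • x₃) w =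
      (a₀ * b₁ - a₁ * b₀) • Rt x₀ x₁ w + (a₀ * b₂ - a₂ * b₀) • Rt x₀ x₂ w
      + (a₀ * b₃ - a₃ * b₀) • Rt x₀ x₃ w + (a₁ * b₂ - a₂ * b₁) • Rt x₁ x₂ w
      + (a₁ * b₃ - a₃ * b₁) • Rt x₁ x₃ w + (a₂ * b₃ - a₃ * b₂) • Rt x₂ x₃ w := by
  simp only [map_add, map_smul, LinearMap.add_apply, LinearMap.smul_apply, h.apply_self]
  rw [h.swap x₁ x₀, h.swap x₂ x₀, h.swap x₃ x₀, h.swap x₂ x₁, h.swap x₃ x₁, h.swap x₃ x₂]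
  module

/-- A Kähler curvature tensor in terms of the four components `R₀₁, R₂₃, R₀₂, R₀₃`. -/
lemma apply_eq (h : IsKahlerCurvature Rt Jb) (he : IsAdapted Jb e) (u v w : V) :
    Rt u v w =
      (inner ℝ (e 0) u * inner ℝ (e 1) v - inner ℝ (e 1) u * inner ℝ (e 0) v) • Rt (e 0) (e 1) w
      + (inner ℝ (e 2) u * inner ℝ (e 3) v - inner ℝ (e 3) u * inner ℝ (e 2) v) • Rt (e 2) (e 3) w
      + ((inner ℝ (e 0) u * inner ℝ (e 2) v - inner ℝ (e 2) u * inner ℝ (e 0) v)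
        - (inner ℝ (e 1) u * inner ℝ (e 3) v - inner ℝ (e 3) u * inner ℝ (e 1) v)) •
          Rt (e 0) (e 2) w
      + ((inner ℝ (e 0) u * inner ℝ (e 3) v - inner ℝ (e 3) u * inner ℝ (e 0) v)
        + (inner ℝ (e 1) u * inner ℝ (e 2) v - inner ℝ (e 2) u * inner ℝ (e 1) v))
        • Rt (e 0) (e 3) w := by
  have c3 : Jb (e 3) = e 2 := by rw [← neg_eq_iff_eq_neg.2 he.map_two, map_neg, h.sq, neg_neg]
  have h13 : Rt (e 1) (e 3) w = - Rt (e 0) (e 2) w := by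
    rw [← h.map_map (e 0) (e 2), he.map_zero, he.map_two, map_neg, LinearMap.neg_apply, neg_neg]
  have h12 : Rt (e 1) (e 2) w = Rt (e 0) (e 3) w := by
    rw [← h.map_map (e 0) (e 3), he.map_zero, c3]
  conv_lhs => rw [← e.sum_repr' u, ← e.sum_repr' v]
  simp only [Fin.sum_univ_four]
  rw [h.apply_combination, h13, h12]
  module

/-- The holomorphic curvature of a vector in terms of the components of the curvature tensor. -/
lemma holCurv_eq (h : IsKahlerCurvature Rt Jb) (he : IsAdapted Jb e) (v : V) (a b c d : ℝ)
    (hv : v = a • e 0 + b • e 1 + c • e 2 + d • e 3) :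
    inner ℝ (Rt v (Jb v) v) (Jb v) =
      inner ℝ (Rt (e 0) (e 1) (e 0)) (e 1) * (a ^ 2 + b ^ 2) ^ 2
      + inner ℝ (Rt (e 2) (e 3) (e 2)) (e 3) * (c ^ 2 + d ^ 2) ^ 2
      - 2 * inner ℝ (Rt (e 0) (e 1) (e 2)) (e 3) * ((a ^ 2 + b ^ 2) * (c ^ 2 + d ^ 2))
      + 4 * inner ℝ (Rt (e 0) (e 2) (e 0)) (e 2) * (a * d + b * c) ^ 2
      + 4 * inner ℝ (Rt (e 0) (e 3) (e 0)) (e 3) * (b * d - a * c) ^ 2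
      + 8 * inner ℝ (Rt (e 0) (e 2) (e 0)) (e 3) * ((a * d + b * c) * (b * d - a * c))
      + 4 * (a * d + b * c) * (inner ℝ (Rt (e 0) (e 2) (e 0)) (e 1) * (a ^ 2 + b ^ 2)
        - inner ℝ (Rt (e 0) (e 2) (e 2)) (e 3) * (c ^ 2 + d ^ 2))
      + 4 * (b * d - a * c) * (inner ℝ (Rt (e 0) (e 3) (e 0)) (e 1) * (a ^ 2 + b ^ 2)
        - inner ℝ (Rt (e 0) (e 3) (e 2)) (e 3) * (c ^ 2 + d ^ 2)) := by
  have c1 : Jb (e 1) = - e 0 := by rw [← he.map_zero, h.sq]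
  have c3 : Jb (e 3) = e 2 := by rw [← neg_eq_iff_eq_neg.2 he.map_two, map_neg, h.sq, neg_neg]
  have hJv : Jb v = (-b) • e 0 + a • e 1 + d • e 2 + (-c) • e 3 := by
    rw [hv]
    simp only [map_add, map_smul, he.map_zero, c1, he.map_two, c3]
    module
  obtain ⟨v0, v1, v2, v3⟩ := e.inner_of_eq hv
  obtain ⟨j0, j1, j2, j3⟩ := e.inner_of_eq hJv
  have hR : ∀ w, Rt v (Jb v) w = (a ^ 2 + b ^ 2) • Rt (e 0) (e 1) w
      - (c ^ 2 + d ^ 2) • Rt (e 2) (e 3) w + (2 * (a * d + b * c)) • Rt (e 0) (e 2) w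
      + (2 * (b * d - a * c)) • Rt (e 0) (e 3) w := by
    intro w
    rw [h.apply_eq he v (Jb v)]
    simp only [v0, v1, v2, v3, j0, j1, j2, j3]
    module
  have hR' : ∀ w z, inner ℝ (Rt w z v) (Jb v) = (a ^ 2 + b ^ 2) * inner ℝ (Rt w z (e 0)) (e 1)
      - (c ^ 2 + d ^ 2) * inner ℝ (Rt w z (e 2)) (e 3)
      + (2 * (a * d + b * c)) * inner ℝ (Rt w z (e 0)) (e 2)
      + (2 * (b * d - a * c)) * inner ℝ (Rt w z (e 0)) (e 3) := by
    intro w z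
    rw [h.pair, hR]
    simp only [inner_add_left, inner_sub_left, inner_smul_left, conj_trivial, h.pair w z]
  rw [hR]
  simp only [inner_add_left, inner_sub_left, inner_smul_left, conj_trivial, hR',
    h.pair (e 2) (e 3) (e 0), h.pair (e 0) (e 1) (e 0) (e 2), h.pair (e 0) (e 1) (e 0) (e 3),
    h.pair (e 0) (e 3) (e 0) (e 2)]
  ring

/-- If the holomorphic curvature only depends on the lengths of the two components of a vector, and
one mixed component of the curvature vanishes, the curvature is that of a product of surfaces. -/
lemma product_of_holCurv (h : IsKahlerCurvature Rt Jb) (he : IsAdapted Jb e)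
    (hmix : inner ℝ (Rt (e 0) (e 2) (e 0)) (e 2) = 0)
    (hH : ∀ v w : V, ‖v‖ = 1 → ‖w‖ = 1 →
      inner ℝ (e 2) v ^ 2 + inner ℝ (e 3) v ^ 2 = inner ℝ (e 2) w ^ 2 + inner ℝ (e 3) w ^ 2 →
      inner ℝ (Rt v (Jb v) v) (Jb v) = inner ℝ (Rt w (Jb w) w) (Jb w)) :
    ∃ A B : ℝ, ∀ u v w, Rt u v w =
      (A * (inner ℝ (e 0) u * inner ℝ (e 1) v - inner ℝ (e 1) u * inner ℝ (e 0) v)) •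
        (inner ℝ (e 0) w • e 1 - inner ℝ (e 1) w • e 0)
      + (B * (inner ℝ (e 2) u * inner ℝ (e 3) v - inner ℝ (e 3) u * inner ℝ (e 2) v)) •
        (inner ℝ (e 2) w • e 3 - inner ℝ (e 3) w • e 2) := by
  -- the hypothesis on unit vectors, extended by homogeneity
  have hom : ∀ a b c d a' b' c' d' : ℝ, a ^ 2 + b ^ 2 = a' ^ 2 + b' ^ 2 →
      c ^ 2 + d ^ 2 = c' ^ 2 + d' ^ 2 → 0 < a ^ 2 + b ^ 2 + c ^ 2 + d ^ 2 →
      ∀ v w, v = a • e 0 + b • e 1 + c • e 2 + d • e 3 →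
      w = a' • e 0 + b' • e 1 + c' • e 2 + d' • e 3 →
      inner ℝ (Rt v (Jb v) v) (Jb v) = inner ℝ (Rt w (Jb w) w) (Jb w) := by
    intro a b c d a' b' c' d' h1 h2 hpos v w hv hw
    have nsq : ∀ (a b c d : ℝ) (v : V), v = a • e 0 + b • e 1 + c • e 2 + d • e 3 →
        ‖v‖ ^ 2 = a ^ 2 + b ^ 2 + c ^ 2 + d ^ 2 := by
      intro a b c d v hv
      obtain ⟨v0, v1, v2, v3⟩ := e.inner_of_eq hv
      rw [← real_inner_self_eq_norm_sq, ← e.sum_inner_mul_inner]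
      simp only [Fin.sum_univ_four, real_inner_comm (e _) v, v0, v1, v2, v3]
      ring
    have n1 := nsq a b c d v hv
    have n2 := nsq a' b' c' d' w hw
    obtain ⟨-, -, v2, v3⟩ := e.inner_of_eq hv
    obtain ⟨-, -, w2, w3⟩ := e.inner_of_eq hw
    have hvw : ‖v‖ = ‖w‖ := by
      have : ‖v‖ ^ 2 = ‖w‖ ^ 2 := by rw [n1, n2]; linarith
      exact (sq_eq_sq₀ (norm_nonneg _) (norm_nonneg _)).1 this
    have hv0 : ‖v‖ ≠ 0 := by
      intro h0
      rw [h0] at n1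
      nlinarith
    have := hH (‖v‖⁻¹ • v) (‖v‖⁻¹ • w) (by rw [norm_smul, norm_inv, norm_norm, inv_mul_cancel₀ hv0])
      (by rw [norm_smul, norm_inv, norm_norm, ← hvw, inv_mul_cancel₀ hv0])
      (by simp only [inner_smul_right, v2, v3, w2, w3, mul_pow, ← mul_add, h2])
    simp only [map_smul, LinearMap.smul_apply, inner_smul_left, inner_smul_right,
      conj_trivial] at this
    have hi : ‖v‖⁻¹ ≠ 0 := inv_ne_zero hv0
    simpa [hi, hv0] using this
  have ev : ∀ a b c d a' b' c' d' : ℝ, a ^ 2 + b ^ 2 = a' ^ 2 + b' ^ 2 →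
      c ^ 2 + d ^ 2 = c' ^ 2 + d' ^ 2 → 0 < a ^ 2 + b ^ 2 + c ^ 2 + d ^ 2 → _ :=
    fun a b c d a' b' c' d' h1 h2 h3 =>
    (h.holCurv_eq he _ a b c d rfl).symm.trans
      ((hom a b c d a' b' c' d' h1 h2 h3 _ _ rfl rfl).trans (h.holCurv_eq he _ a' b' c' d' rfl))
  -- The holomorphic curvature of `a e₀ + b e₁ + c e₂ + d e₃` is a quartic form in `a, b, c, d`.
  -- Sign changes at two different scales separate its parts of degree `(3, 1)` and `(1, 3)`; the
  -- last two lines compare vectors of the same length in the plane of `e₂, e₃`.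
  have E1 := ev 1 0 1 0 1 0 (-1) 0 (by norm_num) (by norm_num) (by norm_num)
  have E2 := ev 1 0 0 1 1 0 0 (-1) (by norm_num) (by norm_num) (by norm_num)
  have E3 := ev 1 0 2 0 1 0 (-2) 0 (by norm_num) (by norm_num) (by norm_num)
  have E4 := ev 1 0 0 2 1 0 0 (-2) (by norm_num) (by norm_num) (by norm_num)
  have E5 := ev 1 0 1 0 1 0 0 1 (by norm_num) (by norm_num) (by norm_num)
  have E6 := ev 1 0 3 4 1 0 5 0 (by norm_num) (by norm_num) (by norm_num)
  rw [hmix] at E1 E2 E3 E4 E5 E6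
  norm_num at E1 E2 E3 E4 E5 E6
  have p1 : inner ℝ (Rt (e 0) (e 2) (e 0)) (e 1) = 0 := by linarith
  have p2 : inner ℝ (Rt (e 0) (e 2) (e 2)) (e 3) = 0 := by linarith
  have p3 : inner ℝ (Rt (e 0) (e 3) (e 0)) (e 1) = 0 := by linarith
  have p4 : inner ℝ (Rt (e 0) (e 3) (e 2)) (e 3) = 0 := by linarith
  have p5 : inner ℝ (Rt (e 0) (e 3) (e 0)) (e 3) = 0 := by linarith
  have p6 : inner ℝ (Rt (e 0) (e 2) (e 0)) (e 3) = 0 := by linarith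
  have h02 : ∀ w, Rt (e 0) (e 2) w = 0 := by
    intro w
    refine ext_inner_right ℝ fun z => ?_
    rw [h.pair, h.apply_eq he]
    simp only [inner_add_left, inner_smul_left, inner_zero_left]
    rw [h.pair (e 0) (e 1), p1, h.pair (e 2) (e 3), p2, hmix, h.pair (e 0) (e 3), p6]
    ring
  have h03 : ∀ w, Rt (e 0) (e 3) w = 0 := by
    intro w
    refine ext_inner_right ℝ fun z => ?_
    rw [h.pair, h.apply_eq he]
    simp only [inner_add_left, inner_smul_left, inner_zero_left]
    rw [h.pair (e 0) (e 1), p3, h.pair (e 2) (e 3), p4, p5, p6]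
    ring
  have c3 : Jb (e 3) = e 2 := by rw [← neg_eq_iff_eq_neg.2 he.map_two, map_neg, h.sq, neg_neg]
  have h01 : Rt (e 0) (e 1) (e 2) = 0 := by
    have hb := h.bianchi (e 0) (e 1) (e 2)
    rw [h.swap (e 2) (e 0), h02, neg_zero, add_zero] at hb
    have h12 : Rt (e 1) (e 2) (e 0) = 0 := by
      rw [← h03 (e 0), ← h.map_map (e 0) (e 3), he.map_zero, c3]
    rwa [h12, add_zero] at hb
  have p7 : inner ℝ (Rt (e 0) (e 1) (e 2)) (e 3) = 0 := by rw [h01, inner_zero_left]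
  refine ⟨inner ℝ (Rt (e 0) (e 1) (e 0)) (e 1), inner ℝ (Rt (e 2) (e 3) (e 2)) (e 3),
    fun u v w => ?_⟩
  refine ext_inner_right ℝ fun z => ?_
  rw [h.apply_eq he, h02, h03]
  simp only [inner_add_left, inner_sub_left, inner_smul_left, conj_trivial, smul_zero, add_zero]
  rw [h.pair (e 0) (e 1) w z, h.pair (e 2) (e 3) w z, h.apply_eq he w z (e 0),
    h.apply_eq he w z (e 2), h02, h03, h02, h03]
  simp only [inner_add_left, inner_smul_left, conj_trivial, smul_zero, add_zero, p7,
    h.pair (e 2) (e 3) (e 0)]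
  ring

end IsKahlerCurvature

/-- The curvature tensor of a product of two surfaces is annihilated by its curvature operators. -/
lemma semisymmetric_of_product {Rt : V → V → V → V} (e : OrthonormalBasis (Fin 4) ℝ V) {A B : ℝ}
    (hR : ∀ u v w, Rt u v w =
      (A * (inner ℝ (e 0) u * inner ℝ (e 1) v - inner ℝ (e 1) u * inner ℝ (e 0) v)) •
        (inner ℝ (e 0) w • e 1 - inner ℝ (e 1) w • e 0)
      + (B * (inner ℝ (e 2) u * inner ℝ (e 3) v - inner ℝ (e 3) u * inner ℝ (e 2) v)) •
        (inner ℝ (e 2) w • e 3 - inner ℝ (e 3) w • e 2)) (u v a b c : V) :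
    Rt u v (Rt a b c) - Rt (Rt u v a) b c - Rt a (Rt u v b) c - Rt a b (Rt u v c) = 0 := by
  have o := orthonormal_iff_ite.1 e.orthonormal
  have c0 : ∀ u v w, inner ℝ (e 0) (Rt u v w) =
      - (A * (inner ℝ (e 0) u * inner ℝ (e 1) v - inner ℝ (e 1) u * inner ℝ (e 0) v)) *
        inner ℝ (e 1) w := by
    intro u v w
    rw [hR]
    simp [inner_add_right, inner_sub_right, inner_smul_right, o]
  have c1 : ∀ u v w, inner ℝ (e 1) (Rt u v w) =
      (A * (inner ℝ (e 0) u * inner ℝ (e 1) v - inner ℝ (e 1) u * inner ℝ (e 0) v)) *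
        inner ℝ (e 0) w := by
    intro u v w
    rw [hR]
    simp [inner_add_right, inner_sub_right, inner_smul_right, o]
  have c2 : ∀ u v w, inner ℝ (e 2) (Rt u v w) =
      - (B * (inner ℝ (e 2) u * inner ℝ (e 3) v - inner ℝ (e 3) u * inner ℝ (e 2) v)) *
        inner ℝ (e 3) w := by
    intro u v w
    rw [hR]
    simp [inner_add_right, inner_sub_right, inner_smul_right, o]
  have c3 : ∀ u v w, inner ℝ (e 3) (Rt u v w) =
      (B * (inner ℝ (e 2) u * inner ℝ (e 3) v - inner ℝ (e 3) u * inner ℝ (e 2) v)) *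
        inner ℝ (e 2) w := by
    intro u v w
    rw [hR]
    simp [inner_add_right, inner_sub_right, inner_smul_right, o]
  rw [hR u v (Rt a b c), hR (Rt u v a), hR a (Rt u v b), hR a b (Rt u v c)]
  simp only [c0, c1, c2, c3]
  module

end Algebra

/-! ### Covariant derivatives of almost complex structures -/

section AlmostHermitian

variable [T2Space M] [RiemannianBundle (fun x : M => TangentSpace (𝓡 4) x)]
  {cov : Connection M} {J : (x : M) → TangentSpace (𝓡 4) x →L[ℝ] TangentSpace (𝓡 4) x}

lemma IsAlmostHermitian.tensorialAt_nablaJ (cov : Connection M) (hJ : IsAlmostHermitian J) (x : M)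
    (v : TangentSpace (𝓡 4) x) : TensorialAt (𝓡 4) (EuclideanSpace ℝ (Fin 4))
      (fun W : Field M => cov (fun y => J y (W y)) x v - J x (cov W x v)) x where
  smul {f W} hf hW := by
    have h1 : (fun y => J y ((f • W) y)) = f • (fun y => J y (W y)) := by ext1 y; simp
    rw [h1, cov_smul cov hf ((hJ.smoothEndAt x).apply_diff hW), cov_smul cov hf hW]
    simp only [map_add, map_smul]
    module
  add {W W'} hW hW' := by
    have h1 : (fun y => J y ((W + W') y)) = (fun y => J y (W y)) + (fun y => J y (W' y)) := by
      ext1 y; simp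
    rw [h1, cov_add cov ((hJ.smoothEndAt x).apply_diff hW) ((hJ.smoothEndAt x).apply_diff hW'),
      cov_add cov hW hW']
    simp only [map_add, add_apply]
    abel

/-- `(∇_v J) w` can be computed with any differentiable extension of `w`. -/
lemma IsAlmostHermitian.nablaJ_eq (hJ : IsAlmostHermitian J) {W : Field M} {x : M}
    (hW : DiffFieldAt W x) (v : TangentSpace (𝓡 4) x) :
    nablaJ cov J x (W x) v = cov (fun y => J y (W y)) x v - J x (cov W x v) :=
  (hJ.tensorialAt_nablaJ cov x v).pointwise (smoothNear_ext (W x)).diffFieldAt hW (ext_self _)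

/-- The tensor `(v, w) ↦ (∇_v J) w` at a point. -/
def IsAlmostHermitian.nablaTensor (cov : Connection M) (hJ : IsAlmostHermitian J) (x : M) :
    TangentSpace (𝓡 4) x →ₗ[ℝ] TangentSpace (𝓡 4) x →ₗ[ℝ] TangentSpace (𝓡 4) x :=
  LinearMap.mk₂ ℝ (fun v w => nablaJ cov J x w v)
    (fun v v' _ => map_add _ v v') (fun c v _ => map_smul _ c v)
    (fun v w w' => map_add (TensorialAt.mkHom _ x (hJ.tensorialAt_nablaJ cov x v)) w w')
    (fun c v w => map_smul (TensorialAt.mkHom _ x (hJ.tensorialAt_nablaJ cov x v)) c w)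

@[simp] lemma IsAlmostHermitian.nablaTensor_apply (hJ : IsAlmostHermitian J) (x : M)
    (v w : TangentSpace (𝓡 4) x) : hJ.nablaTensor cov x v w = nablaJ cov J x w v := rfl

lemma IsAlmostHermitian.inner_map (hJ : IsAlmostHermitian J) (x : M) (v w : TangentSpace (𝓡 4) x) :
    inner ℝ (J x v) w = - inner ℝ v (J x w) := by
  rw [← hJ.orthogonal x v (J x w), hJ.sq, inner_neg_right, neg_neg]

lemma IsKahler.cov_map (hJ : IsKahler cov J) {W : Field M} {x : M} (hW : DiffFieldAt W x)
    (v : TangentSpace (𝓡 4) x) : cov (fun y => J y (W y)) x v = J x (cov W x v) := by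
  rw [← sub_eq_zero, ← hJ.nablaJ_eq hW, hJ.parallel]

variable [IsContMDiffRiemannianBundle (𝓡 4) ∞ (EuclideanSpace ℝ (Fin 4))
  (fun x : M => TangentSpace (𝓡 4) x)]

/-- The curvature operators commute with a parallel complex structure. -/
lemma IsKahler.R_map (hcov : IsLeviCivita cov) (hJ : IsKahler cov J) (x : M)
    (u v w : TangentSpace (𝓡 4) x) : R cov x u v (J x w) = J x (R cov x u v w) := by
  have hw := smoothNear_ext w
  have key : ∀ {A B : Field M}, SmoothNear A x → SmoothNear B x →
      cov (fun y => cov (fun y => J y (ext w y)) y (B y)) x (A x) =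
        J x (cov (fun y => cov (ext w) y (B y)) x (A x)) := by
    intro A B hA hB
    have hd := (hw.cov_apply hcov.smooth hB)
    rw [← hJ.cov_map hd.diffFieldAt]
    congr 1
    refine cov_congr cov ((hJ.smoothNear hw).cov_apply hcov.smooth hB).diffFieldAt ?_
    filter_upwards [hw] with y hy
    exact hJ.cov_map hy.diffFieldAt _
  have h := hcov.R_eq (smoothNear_ext u) (smoothNear_ext v) (hJ.smoothNear hw)
  simp only [ext_self] at h
  rw [h, R, curvField, curvField, key (smoothNear_ext u) (smoothNear_ext v),
    key (smoothNear_ext v) (smoothNear_ext u), hJ.cov_map hw.diffFieldAt, map_sub, map_sub]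

lemma IsKahler.isKahlerCurvature (hcov : IsLeviCivita cov) (hJ : IsKahler cov J) (x : M) :
    IsKahlerCurvature (hcov.curvTensor x) (J x).toLinearMap where
  swap := IsLeviCivita.R_swap x
  skew := hcov.R_skew x
  bianchi := hcov.R_bianchi x
  sq := hJ.sq x
  isometry := hJ.orthogonal x
  comm := hJ.R_map hcov x

end AlmostHermitian

/-! ### Standard frames -/

section Frame

variable [RiemannianBundle (fun x : M => TangentSpace (𝓡 4) x)]
  {cov : Connection M} {J : (x : M) → TangentSpace (𝓡 4) x →L[ℝ] TangentSpace (𝓡 4) x}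

lemma natOpp_of_mem {x : M} {v : TangentSpace (𝓡 4) x} (hv : v ∈ nullityJ cov J x) :
    natOpp cov J x v = - J x v := by
  have h : (nullityJ cov J x).starProjection v = v :=
    Submodule.starProjection_eq_self_iff.2 hv
  simp only [natOpp, ContinuousLinearMap.comp_apply, sub_apply, ContinuousLinearMap.id_apply,
    smul_apply, h]
  rw [← map_neg]
  congr 1
  module

lemma natOpp_of_mem_orthogonal {x : M} {v : TangentSpace (𝓡 4) x}
    (hv : v ∈ (nullityJ cov J x)ᗮ) : natOpp cov J x v = J x v := by
  have h : (nullityJ cov J x).starProjection v = 0 :=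
    (Submodule.starProjection_apply_eq_zero_iff _).2 hv
  simp [natOpp, h]

variable {U : Set M} {e : Fin 4 → (x : M) → TangentSpace (𝓡 4) x}

namespace IsStandardFrame

/-- The orthonormal basis given by a standard frame at a point. -/
def basis (hf : IsStandardFrame cov J U e) {x : M} (hx : x ∈ U) :
    OrthonormalBasis (Fin 4) ℝ (TangentSpace (𝓡 4) x) :=
  (basisOfOrthonormalOfCardEqFinrank (hf.orthonormal x hx)
    (by change _ = Module.finrank ℝ (EuclideanSpace ℝ (Fin 4)); simp)).toOrthonormalBasis
    (by simpa using hf.orthonormal x hx)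

@[simp] lemma basis_apply (hf : IsStandardFrame cov J U e) {x : M} (hx : x ∈ U) (i : Fin 4) :
    hf.basis hx i = e i x := by
  simp [basis]

lemma inner_eq (hf : IsStandardFrame cov J U e) {x : M} (hx : x ∈ U) (i j : Fin 4) :
    inner ℝ (e i x) (e j x) = if i = j then (1 : ℝ) else 0 :=
  orthonormal_iff_ite.1 (hf.orthonormal x hx) i j

lemma norm_eq (hf : IsStandardFrame cov J U e) {x : M} (hx : x ∈ U) (i : Fin 4) : ‖e i x‖ = 1 :=
  (hf.orthonormal x hx).1 i

lemma smoothNear (hf : IsStandardFrame cov J U e) {x : M} (hx : x ∈ U) (i : Fin 4) :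
    SmoothNear (e i) x := (hf.smooth i).smoothNear hf.isOpen hx

lemma eventually_mem (hf : IsStandardFrame cov J U e) {x : M} (hx : x ∈ U) : ∀ᶠ y in 𝓝 x, y ∈ U :=
  hf.isOpen.mem_nhds hx

lemma natOpp_zero (hf : IsStandardFrame cov J U e) {x : M} (hx : x ∈ U) :
    natOpp cov J x (e 0 x) = e 1 x := by
  rw [natOpp_of_mem_orthogonal (hf.perp x hx).1, (hf.oriented x hx).1]

lemma natOpp_two (hf : IsStandardFrame cov J U e) {x : M} (hx : x ∈ U) :
    natOpp cov J x (e 2 x) = - e 3 x := by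
  rw [natOpp_of_mem (hf.null x hx).1, (hf.oriented x hx).2]

lemma isAdapted (hf : IsStandardFrame cov J U e) {x : M} (hx : x ∈ U) :
    IsAdapted (natOpp cov J x).toLinearMap (hf.basis hx) where
  map_zero := by simpa using hf.natOpp_zero hx
  map_two := by simpa using hf.natOpp_two hx

variable [IsContMDiffRiemannianBundle (𝓡 4) ∞ (EuclideanSpace ℝ (Fin 4))
  (fun x : M => TangentSpace (𝓡 4) x)]

lemma inner_cov_swap (hcov : IsLeviCivita cov) (hf : IsStandardFrame cov J U e) {x : M} (hx : x ∈ U)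
    (i j : Fin 4) (v : TangentSpace (𝓡 4) x) :
    inner ℝ (cov (e i) x v) (e j x) = - inner ℝ (cov (e j) x v) (e i x) := by
  have h1 := hcov.dirDeriv_inner (hf.smoothNear hx i).diffFieldAt (hf.smoothNear hx j).diffFieldAt v
  have h2 : dirDeriv (fun y => inner ℝ (e i y) (e j y)) x v = 0 := by
    rw [dirDeriv_congr (g := fun _ => if i = j then (1 : ℝ) else 0), dirDeriv_const]
    filter_upwards [hf.eventually_mem hx] with y hy using hf.inner_eq hy i j
  rw [h2, real_inner_comm (cov (e j) x v)] at h1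
  linarith

variable [T2Space M]

/-- As `J̄` is parallel, all mixed connection forms of a standard frame are determined by `∇J`. -/
lemma inner_cov (hJ : IsAlmostHermitian J)
    (hK : IsKahler cov (natOpp cov J)) (hf : IsStandardFrame cov J U e) {x : M} (hx : x ∈ U)
    (v : TangentSpace (𝓡 4) x) :
    inner ℝ (cov (e 0) x v) (e 2 x) = - (alpha cov J x / 2) * inner ℝ (e 1 x) v ∧
    inner ℝ (cov (e 0) x v) (e 3 x) = alpha cov J x / 2 * inner ℝ (e 0 x) v ∧
    inner ℝ (cov (e 1) x v) (e 2 x) = alpha cov J x / 2 * inner ℝ (e 0 x) v ∧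
    inner ℝ (cov (e 1) x v) (e 3 x) = alpha cov J x / 2 * inner ℝ (e 1 x) v := by
  have hd := fun i => (hf.smoothNear hx i).diffFieldAt
  have b3 : natOpp cov J x (e 3 x) = e 2 x := by
    have := hK.sq x (e 2 x)
    rw [hf.natOpp_two hx, map_neg] at this
    exact neg_injective this
  have j3 : J x (e 3 x) = - e 2 x := by rw [← (hf.oriented x hx).2, hJ.sq]
  have h1 : cov (e 1) x v = natOpp cov J x (cov (e 0) x v) := by
    rw [← hK.cov_map (hd 0), cov_congr cov (hd 1)]
    filter_upwards [hf.eventually_mem hx] with y hy using (hf.natOpp_zero hy).symm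
  have h2 : nablaJ cov J x (e 0 x) v = cov (e 1) x v - J x (cov (e 0) x v) := by
    rw [hJ.nablaJ_eq (hd 0), cov_congr cov (hd 1)]
    filter_upwards [hf.eventually_mem hx] with y hy using (hf.oriented y hy).1.symm
  have g12 : inner ℝ (cov (e 1) x v) (e 2 x) = inner ℝ (cov (e 0) x v) (e 3 x) := by
    rw [h1, hK.inner_map, hf.natOpp_two hx, inner_neg_right, neg_neg]
  have g13 : inner ℝ (cov (e 1) x v) (e 3 x) = - inner ℝ (cov (e 0) x v) (e 2 x) := by
    rw [h1, hK.inner_map, b3]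
  have n2 := hf.nablaOmega x hx v (e 0 x) (e 2 x)
  have n3 := hf.nablaOmega x hx v (e 0 x) (e 3 x)
  rw [h2, inner_sub_left, hJ.inner_map, (hf.oriented x hx).2] at n2
  rw [h2, inner_sub_left, hJ.inner_map, j3, inner_neg_right] at n3
  simp [hf.inner_eq hx, hf.norm_eq hx] at n2 n3
  refine ⟨?_, ?_, ?_, ?_⟩ <;> linarith

lemma alpha_eq (hJ : IsAlmostHermitian J)
    (hK : IsKahler cov (natOpp cov J)) (hf : IsStandardFrame cov J U e) {x : M} (hx : x ∈ U) :
    alpha cov J x = 2 * inner ℝ (cov (e 0) x (e 0 x)) (e 3 x) := by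
  rw [(hf.inner_cov hJ hK hx _).2.1, hf.inner_eq hx]
  simp
  ring

lemma contMDiffAt_alpha (hcov : IsLeviCivita cov) (hJ : IsAlmostHermitian J)
    (hK : IsKahler cov (natOpp cov J)) (hf : IsStandardFrame cov J U e) {x : M} (hx : x ∈ U) :
    ContMDiffAt (𝓡 4) 𝓘(ℝ, ℝ) ∞ (alpha cov J) x := by
  have h : ContMDiffAt (𝓡 4) 𝓘(ℝ, ℝ) ∞
      (fun y => 2 * inner ℝ (cov (e 0) y (e 0 y)) (e 3 y)) x :=
    contMDiffAt_const.mul (((hf.smoothNear hx 0).cov_apply hcov.smooth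
      (hf.smoothNear hx 0)).inner (hf.smoothNear hx 3)).self_of_nhds
  refine h.congr_of_eventuallyEq ?_
  filter_upwards [hf.eventually_mem hx] with y hy using hf.alpha_eq hJ hK hy

/-- The structure equation for the curvature component `⟨R(A,B)E₁, E₃⟩`. -/
lemma inner_R_zero_two (hcov : IsLeviCivita cov) (hf : IsStandardFrame cov J U e) {x : M}
    (hx : x ∈ U) {A B : Field M} (hA : SmoothNear A x) (hB : SmoothNear B x) :
    inner ℝ (R cov x (A x) (B x) (e 0 x)) (e 2 x) =
      dirDeriv (fun y => inner ℝ (cov (e 0) y (B y)) (e 2 y)) x (A x)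
      - dirDeriv (fun y => inner ℝ (cov (e 0) y (A y)) (e 2 y)) x (B x)
      - inner ℝ (cov (e 0) x (VectorField.mlieBracket (𝓡 4) A B x)) (e 2 x)
      - (inner ℝ (cov (e 0) x (B x)) (e 1 x) * inner ℝ (cov (e 2) x (A x)) (e 1 x)
        + inner ℝ (cov (e 0) x (B x)) (e 3 x) * inner ℝ (cov (e 2) x (A x)) (e 3 x))
      + (inner ℝ (cov (e 0) x (A x)) (e 1 x) * inner ℝ (cov (e 2) x (B x)) (e 1 x)
        + inner ℝ (cov (e 0) x (A x)) (e 3 x) * inner ℝ (cov (e 2) x (B x)) (e 3 x)) := by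
  have h0 := hf.smoothNear hx 0
  have h2 := hf.smoothNear hx 2
  have ex : ∀ a b : TangentSpace (𝓡 4) x, inner ℝ (cov (e 0) x a) (cov (e 2) x b) =
      inner ℝ (cov (e 0) x a) (e 1 x) * inner ℝ (cov (e 2) x b) (e 1 x)
        + inner ℝ (cov (e 0) x a) (e 3 x) * inner ℝ (cov (e 2) x b) (e 3 x) := by
    intro a b
    rw [← (hf.basis hx).sum_inner_mul_inner]
    have z : ∀ i, ∀ v, inner ℝ (cov (e i) x v) (e i x) = 0 := fun i v => by
      have := hf.inner_cov_swap hcov hx i i v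
      linarith
    simp only [Fin.sum_univ_four, basis_apply, z, real_inner_comm (cov (e 2) x b), mul_zero,
      zero_mul, zero_add, add_zero]
  rw [hcov.R_eq hA hB h0,
    hcov.dirDeriv_inner (h0.cov_apply hcov.smooth hB).diffFieldAt h2.diffFieldAt,
    hcov.dirDeriv_inner (h0.cov_apply hcov.smooth hA).diffFieldAt h2.diffFieldAt, ← ex, ← ex]
  simp only [curvField, inner_sub_left]
  ring

/-- `⟨R(E₂,E₄)E₁, E₃⟩ = E₄(α)/2 - α²/4`. -/
lemma inner_R_one_three (hcov : IsLeviCivita cov) (hJ : IsAlmostHermitian J)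
    (hK : IsKahler cov (natOpp cov J)) (hf : IsStandardFrame cov J U e) {x : M} (hx : x ∈ U) :
    inner ℝ (R cov x (e 1 x) (e 3 x) (e 0 x)) (e 2 x) =
      dirDeriv (alpha cov J) x (e 3 x) / 2 - alpha cov J x ^ 2 / 4 := by
  have h1 := hf.smoothNear hx 1
  have h3 := hf.smoothNear hx 3
  have G := fun {y} (hy : y ∈ U) => hf.inner_cov hJ hK hy
  have d1 : dirDeriv (fun y => inner ℝ (cov (e 0) y (e 3 y)) (e 2 y)) x (e 1 x) = 0 := by
    rw [dirDeriv_congr (g := fun _ => (0 : ℝ)), dirDeriv_const]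
    filter_upwards [hf.eventually_mem hx] with y hy
    rw [(G hy _).1, hf.inner_eq hy]
    simp
  have d2 : dirDeriv (fun y => inner ℝ (cov (e 0) y (e 1 y)) (e 2 y)) x (e 3 x) =
      - (1 / 2) * dirDeriv (alpha cov J) x (e 3 x) := by
    rw [dirDeriv_congr (g := fun y => - (1 / 2) * alpha cov J y), dirDeriv_const_mul]
    · exact (hf.contMDiffAt_alpha hcov hJ hK hx).mdifferentiableAt (by simp)
    filter_upwards [hf.eventually_mem hx] with y hy
    rw [(G hy _).1, hf.inner_eq hy]
    simp
    ring
  have hz : inner ℝ (cov (e 1) x (e 3 x)) (e 1 x) = 0 := by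
    have := hf.inner_cov_swap hcov hx 1 1 (e 3 x)
    linarith
  rw [hf.inner_R_zero_two hcov hx h1 h3, d1, d2, hcov.mlieBracket_eq h1.diffFieldAt h3.diffFieldAt,
    (G hx _).1, inner_sub_right, real_inner_comm _ (e 1 x), real_inner_comm _ (e 1 x), hz,
    hf.inner_cov_swap hcov hx 3 1, (G hx _).2.2.2, hf.inner_cov_swap hcov hx 2 1,
    hf.inner_cov_swap hcov hx 2 1, (G hx _).2.2.1, (G hx _).2.2.1, (G hx _).2.1, (G hx _).2.1]
  simp [hf.inner_eq hx, hf.norm_eq hx]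
  ring

/-- `⟨R(E₁,E₃)E₁, E₃⟩ = α/2 ⟨∇_{E₃}E₃, E₄⟩ - α²/4`. -/
lemma inner_R_zero_two_self (hcov : IsLeviCivita cov) (hJ : IsAlmostHermitian J)
    (hK : IsKahler cov (natOpp cov J)) (hf : IsStandardFrame cov J U e) {x : M} (hx : x ∈ U) :
    inner ℝ (R cov x (e 0 x) (e 2 x) (e 0 x)) (e 2 x) =
      alpha cov J x / 2 * inner ℝ (cov (e 2) x (e 2 x)) (e 3 x) - alpha cov J x ^ 2 / 4 := by
  have h1 := hf.smoothNear hx 0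
  have h3 := hf.smoothNear hx 2
  have G := fun {y} (hy : y ∈ U) => hf.inner_cov hJ hK hy
  have d1 : dirDeriv (fun y => inner ℝ (cov (e 0) y (e 2 y)) (e 2 y)) x (e 0 x) = 0 := by
    rw [dirDeriv_congr (g := fun _ => (0 : ℝ)), dirDeriv_const]
    filter_upwards [hf.eventually_mem hx] with y hy
    rw [(G hy _).1, hf.inner_eq hy]
    simp
  have d2 : dirDeriv (fun y => inner ℝ (cov (e 0) y (e 0 y)) (e 2 y)) x (e 2 x) = 0 := by
    rw [dirDeriv_congr (g := fun _ => (0 : ℝ)), dirDeriv_const]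
    filter_upwards [hf.eventually_mem hx] with y hy
    rw [(G hy _).1, hf.inner_eq hy]
    simp
  rw [hf.inner_R_zero_two hcov hx h1 h3, d1, d2, hcov.mlieBracket_eq h1.diffFieldAt h3.diffFieldAt,
    (G hx _).1, inner_sub_right, real_inner_comm _ (e 1 x), real_inner_comm _ (e 1 x),
    hf.inner_cov_swap hcov hx 2 1, hf.inner_cov_swap hcov hx 2 1, (G hx _).2.2.1, (G hx _).2.2.1,
    (G hx _).2.1, (G hx _).2.1]
  simp [hf.inner_eq hx, hf.norm_eq hx]
  ring

/-- `E₄(α) + α ⟨∇_{E₃}E₃, E₄⟩ = α²`: the curvature of the Kähler metric `(g, J̄)` is a form of type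
`(1,1)`, so that `R(J̄E₁, J̄E₃) = R(E₁, E₃)`. -/
lemma dirDeriv_alpha_add (hcov : IsLeviCivita cov) (hJ : IsAlmostHermitian J)
    (hK : IsKahler cov (natOpp cov J)) (hf : IsStandardFrame cov J U e) {x : M} (hx : x ∈ U) :
    dirDeriv (alpha cov J) x (e 3 x) + alpha cov J x * inner ℝ (cov (e 2) x (e 2 x)) (e 3 x)
      = alpha cov J x ^ 2 := by
  have h := (hK.isKahlerCurvature hcov x).map_map (e 0 x) (e 2 x) (e 0 x)
  simp only [ContinuousLinearMap.coe_coe, hf.natOpp_zero hx, hf.natOpp_two hx, map_neg,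
    LinearMap.neg_apply, IsLeviCivita.curvTensor_apply] at h
  have h' := congrArg (fun z => inner ℝ z (e 2 x)) h
  simp only [inner_neg_left] at h'
  rw [hf.inner_R_one_three hcov hJ hK hx, hf.inner_R_zero_two_self hcov hJ hK hx] at h'
  linarith

end IsStandardFrame

end Frame

/-! ### The algebra of `∇J` on a Hermitian surface -/

section Algebra

variable {V : Type*} [NormedAddCommGroup V] [InnerProductSpace ℝ V]

/-- `N v w = (∇_v J) w` has the algebraic symmetries of the covariant derivative of an integrable
orthogonal complex structure `J`. -/
structure IsHermitianNabla (N : V →ₗ[ℝ] V →ₗ[ℝ] V) (J : V →ₗ[ℝ] V) : Prop where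
  sq : ∀ v, J (J v) = - v
  isometry : ∀ u v, inner ℝ (J u) (J v) = inner ℝ u v
  map_right : ∀ v w, N v (J w) = - J (N v w)
  map_left : ∀ v w, N (J v) w = J (N v w)
  skew : ∀ v w z, inner ℝ (N v w) z = - inner ℝ (N v z) w

namespace IsHermitianNabla

variable {N : V →ₗ[ℝ] V →ₗ[ℝ] V} {J : V →ₗ[ℝ] V}

lemma isometry_left (h : IsHermitianNabla N J) (u v : V) :
    inner ℝ (J u) v = - inner ℝ u (J v) := by
  rw [← h.isometry u, h.sq, inner_neg_right, neg_neg]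

lemma inner_self (h : IsHermitianNabla N J) (u : V) : inner ℝ u (J u) = 0 := by
  have := h.isometry_left u u
  rw [real_inner_comm] at this
  linarith

lemma norm_map (h : IsHermitianNabla N J) (u : V) : ‖J u‖ = ‖u‖ := by
  rw [@norm_eq_sqrt_real_inner V, @norm_eq_sqrt_real_inner V, h.isometry]

lemma inner_apply_self (h : IsHermitianNabla N J) (v w : V) : inner ℝ (N v w) w = 0 := by
  have := h.skew v w w
  linarith

lemma inner_apply_map (h : IsHermitianNabla N J) (v w : V) : inner ℝ (N v w) (J w) = 0 := by
  have := h.skew v w (J w)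
  rw [h.map_right, inner_neg_left, h.isometry_left] at this
  linarith

/-- Two orthogonal `J`-invariant planes give an orthonormal basis. -/
lemma exists_basis (h : IsHermitianNabla N J) (hdim : Module.finrank ℝ V = 4) {u d : V}
    (hu : ‖u‖ = 1) (hd : ‖d‖ = 1) (hud : inner ℝ u d = 0) (hud' : inner ℝ u (J d) = 0) :
    ∃ f : OrthonormalBasis (Fin 4) ℝ V, f 0 = u ∧ f 1 = J u ∧ f 2 = d ∧ f 3 = J d := by
  have hJud : inner ℝ (J u) d = 0 := by rw [h.isometry_left, hud', neg_zero]
  have horth : Orthonormal ℝ ![u, J u, d, J d] := by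
    rw [orthonormal_iff_ite]
    intro i j
    fin_cases i <;> fin_cases j <;>
      simp [h.isometry, hu, hd, hud, hud', h.norm_map, h.inner_self, hJud,
        real_inner_comm u, real_inner_comm (J u) d, real_inner_comm d (J d)]
  have := FiniteDimensional.of_finrank_eq_succ hdim
  set f : OrthonormalBasis (Fin 4) ℝ V :=
    (basisOfOrthonormalOfCardEqFinrank horth (by simp [hdim])).toOrthonormalBasis
      (by simpa using horth) with hf
  have hfc : ∀ i, f i = ![u, J u, d, J d] i := fun i => by simp [hf]
  exact ⟨f, hfc 0, hfc 1, hfc 2, hfc 3⟩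

/-- Let `D` be the nullity space of `∇J`. If `u` is a unit vector orthogonal to `D`, then
`(∇_u J)u` lies in `D`, and after normalisation it completes `u, Ju` to a frame in which `∇J` has
its standard form. -/
lemma standard_form (h : IsHermitianNabla N J) (hdim : Module.finrank ℝ V = 4) (D : Submodule ℝ V)
    (hD : ∀ v, v ∈ D ↔ ∀ w, N v w = 0) (hbot : D ≠ ⊥) {u : V} (hu : ‖u‖ = 1) (huD : u ∈ Dᗮ)
    (hN : ∃ v w, N v w ≠ 0) {d : V} (hd : d = ‖N u u‖⁻¹ • N u u) :
    d ∈ D ∧ J d ∈ D ∧ J u ∈ Dᗮ ∧ ∃ f : OrthonormalBasis (Fin 4) ℝ V, f 0 = u ∧ f 1 = J u ∧ f 2 = d ∧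
      f 3 = J d ∧ ∀ a v w, inner ℝ (N a v) w = ‖N u u‖ *
        (inner ℝ (f 0) a * ((inner ℝ (f 0) v * inner ℝ (f 2) w - inner ℝ (f 2) v * inner ℝ (f 0) w)
            - (inner ℝ (f 1) v * inner ℝ (f 3) w - inner ℝ (f 3) v * inner ℝ (f 1) w))
          + inner ℝ (f 1) a * ((inner ℝ (f 0) v * inner ℝ (f 3) w
              - inner ℝ (f 3) v * inner ℝ (f 0) w)
            + (inner ℝ (f 1) v * inner ℝ (f 2) w - inner ℝ (f 2) v * inner ℝ (f 1) w))) := by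
  have hDJ : ∀ v ∈ D, J v ∈ D := fun v hv => (hD _).2 fun w => by
    rw [h.map_left, (hD v).1 hv, map_zero]
  have huJ : J u ∈ Dᗮ := by
    rw [Submodule.mem_orthogonal]
    intro z hz
    rw [real_inner_comm, h.isometry_left, Submodule.inner_left_of_mem_orthogonal (hDJ z hz) huD,
      neg_zero]
  -- an auxiliary basis `u, Ju, c, Jc` with `c ∈ D`
  obtain ⟨c, hc, hcD⟩ : ∃ c : V, ‖c‖ = 1 ∧ c ∈ D := by
    obtain ⟨q, hq, hq0⟩ := Submodule.exists_mem_ne_zero_of_ne_bot hbot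
    exact ⟨‖q‖⁻¹ • q,
      by rw [norm_smul, norm_inv, norm_norm, inv_mul_cancel₀ (norm_ne_zero_iff.2 hq0)],
      D.smul_mem _ hq⟩
  obtain ⟨g, g0, g1, g2, g3⟩ := h.exists_basis hdim hu hc
    (Submodule.inner_left_of_mem_orthogonal hcD huD)
    (Submodule.inner_left_of_mem_orthogonal (hDJ c hcD) huD)
  have hz2 : ∀ w, N (g 2) w = 0 := by rw [g2]; exact (hD c).1 hcD
  have hz3 : ∀ w, N (g 3) w = 0 := by rw [g3]; exact (hD _).1 (hDJ c hcD)
  have hnD : N u u ∈ D := by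
    rw [← g.sum_repr' (N u u)]
    simp only [Fin.sum_univ_four, g0, g1, g2, g3, real_inner_comm (N u u), h.inner_apply_self,
      h.inner_apply_map, zero_smul, zero_add]
    exact D.add_mem (D.smul_mem _ hcD) (D.smul_mem _ (hDJ c hcD))
  have hn0 : N u u ≠ 0 := by
    intro h0
    have hNu : ∀ w, N u w = 0 := by
      have k2 : N u (g 2) = 0 := by
        rw [← g.sum_repr' (N u (g 2))]
        have i0 : inner ℝ (g 0) (N u (g 2)) = 0 := by
          rw [real_inner_comm, h.skew, g0, h0, inner_zero_left, neg_zero]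
        have i1 : inner ℝ (g 1) (N u (g 2)) = 0 := by
          rw [real_inner_comm, h.skew, g1, h.map_right, h0, map_zero, neg_zero, inner_zero_left,
            neg_zero]
        have i2 : inner ℝ (g 2) (N u (g 2)) = 0 := by rw [real_inner_comm, h.inner_apply_self]
        have i3 : inner ℝ (g 3) (N u (g 2)) = 0 := by
          rw [real_inner_comm, g3, ← g2, h.inner_apply_map]
        simp [Fin.sum_univ_four, i0, i1, i2, i3]
      have k3 : N u (g 3) = 0 := by rw [g3, h.map_right, ← g2, k2, map_zero, neg_zero]
      intro w
      rw [← g.sum_repr' w]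
      simp [Fin.sum_univ_four, k2, k3, g0, g1, h.map_right, h0]
    obtain ⟨v, w, hvw⟩ := hN
    apply hvw
    rw [← g.sum_repr' v]
    simp [Fin.sum_univ_four, hz2, hz3, g0, g1, h.map_left, hNu]
  have hnorm : ‖N u u‖ ≠ 0 := norm_ne_zero_iff.2 hn0
  have hn : N u u = ‖N u u‖ • d := by rw [hd, smul_smul, mul_inv_cancel₀ hnorm, one_smul]
  have hd1 : ‖d‖ = 1 := by rw [hd, norm_smul, norm_inv, norm_norm, inv_mul_cancel₀ hnorm]
  have hdD : d ∈ D := by rw [hd]; exact D.smul_mem _ hnD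
  obtain ⟨f, f0, f1, f2, f3⟩ := h.exists_basis hdim hu hd1
    (Submodule.inner_left_of_mem_orthogonal hdD huD)
    (Submodule.inner_left_of_mem_orthogonal (hDJ d hdD) huD)
  refine ⟨hdD, hDJ d hdD, huJ, f, f0, f1, f2, f3, ?_⟩
  generalize ‖N u u‖ = k at hn
  have o := orthonormal_iff_ite.1 f.orthonormal
  have hz2 : ∀ w, N (f 2) w = 0 := by rw [f2]; exact (hD d).1 hdD
  have hz3 : ∀ w, N (f 3) w = 0 := by rw [f3]; exact (hD _).1 (hDJ d hdD)
  have k0 : N (f 0) (f 0) = k • f 2 := by rw [f0, f2, hn]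
  have k1 : N (f 0) (f 1) = - k • f 3 := by rw [f0, f1, f3, h.map_right, hn, map_smul, neg_smul]
  have k2 : N (f 0) (f 2) = - k • f 0 := by
    rw [← f.sum_repr' (N (f 0) (f 2))]
    have i0 : inner ℝ (f 0) (N (f 0) (f 2)) = - k := by
      rw [real_inner_comm, h.skew, k0, inner_smul_left, o]; simp
    have i1 : inner ℝ (f 1) (N (f 0) (f 2)) = 0 := by
      rw [real_inner_comm, h.skew, k1, inner_smul_left, o]; simp
    have i2 : inner ℝ (f 2) (N (f 0) (f 2)) = 0 := by rw [real_inner_comm, h.inner_apply_self]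
    have i3 : inner ℝ (f 3) (N (f 0) (f 2)) = 0 := by
      rw [real_inner_comm, f3, ← f2, h.inner_apply_map]
    simp [Fin.sum_univ_four, i0, i1, i2, i3]
  have k3 : N (f 0) (f 3) = k • f 1 := by
    rw [f3, h.map_right, ← f2, k2, map_smul, f0, f1]; module
  have j0 : J (f 0) = f 1 := by rw [f0, f1]
  have j1 : J (f 1) = - f 0 := by rw [f0, f1, h.sq]
  have j2 : J (f 2) = f 3 := by rw [f2, f3]
  have j3 : J (f 3) = - f 2 := by rw [f2, f3, h.sq]
  have hN1 : ∀ w, N (f 1) w = J (N (f 0) w) := fun w => by rw [← j0, h.map_left]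
  intro a v w
  have hNa : N a v = inner ℝ (f 0) a • N (f 0) v + inner ℝ (f 1) a • J (N (f 0) v) := by
    conv_lhs => rw [← f.sum_repr' a]
    simp [Fin.sum_univ_four, hz2, hz3, hN1]
  have hNv : N (f 0) v = inner ℝ (f 0) v • (k • f 2) + inner ℝ (f 1) v • (-k • f 3)
      + inner ℝ (f 2) v • (-k • f 0) + inner ℝ (f 3) v • (k • f 1) := by
    conv_lhs => rw [← f.sum_repr' v]
    simp only [Fin.sum_univ_four, map_add, map_smul, k0, k1, k2, k3]
  rw [hNa, hNv]
  simp only [map_add, map_smul, j0, j1, j2, j3, inner_add_left, inner_smul_left, conj_trivial,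
    inner_neg_left]
  ring

/-- The norm of a tensor in standard form. -/
lemma sum_norm_sq {ι : Type*} [Fintype ι] (b : OrthonormalBasis ι ℝ V)
    (f : OrthonormalBasis (Fin 4) ℝ V) (k : ℝ)
    (hN : ∀ a v w, inner ℝ (N a v) w = k *
        (inner ℝ (f 0) a * ((inner ℝ (f 0) v * inner ℝ (f 2) w - inner ℝ (f 2) v * inner ℝ (f 0) w)
            - (inner ℝ (f 1) v * inner ℝ (f 3) w - inner ℝ (f 3) v * inner ℝ (f 1) w))
          + inner ℝ (f 1) a * ((inner ℝ (f 0) v * inner ℝ (f 3) w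
              - inner ℝ (f 3) v * inner ℝ (f 0) w)
            + (inner ℝ (f 1) v * inner ℝ (f 2) w - inner ℝ (f 2) v * inner ℝ (f 1) w)))) :
    ∑ i, ∑ j, ‖N (b i) (b j)‖ ^ 2 = 8 * k ^ 2 := by
  have o := orthonormal_iff_ite.1 f.orthonormal
  have h1 : ∀ i, ∑ j, ‖N (b i) (b j)‖ ^ 2 = ∑ j, ‖N (b i) (f j)‖ ^ 2 := by
    intro i
    have := sum_orthonormalBasis_eq b f
      (LinearMap.mk₂ ℝ (fun z z' => inner ℝ (N (b i) z) (N (b i) z')) (by simp [inner_add_left])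
        (by simp [inner_smul_left]) (by simp [inner_add_right]) (by simp [inner_smul_right]))
    simpa only [LinearMap.mk₂_apply, real_inner_self_eq_norm_sq] using this
  have h2 : ∀ j, ∑ i, ‖N (b i) (f j)‖ ^ 2 = ∑ i, ‖N (f i) (f j)‖ ^ 2 := by
    intro j
    have := sum_orthonormalBasis_eq b f
      (LinearMap.mk₂ ℝ (fun z z' => inner ℝ (N z (f j)) (N z' (f j))) (by simp [inner_add_left])
        (by simp [inner_smul_left]) (by simp [inner_add_right]) (by simp [inner_smul_right]))
    simpa only [LinearMap.mk₂_apply, real_inner_self_eq_norm_sq] using this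
  have h3 : ∀ v : V, ‖v‖ ^ 2 = ∑ l, inner ℝ v (f l) ^ 2 := fun v => by
    rw [← real_inner_self_eq_norm_sq, ← f.sum_inner_mul_inner]
    exact Finset.sum_congr rfl fun l _ => by rw [real_inner_comm v, pow_two]
  simp only [h1]
  rw [Finset.sum_comm]
  simp only [h2]
  simp only [Fin.sum_univ_four, h3, hN, o]
  simp
  ring

end IsHermitianNabla

end Algebra

/-! ### Existence of standard frames -/

section FrameExistence

variable [T2Space M] [RiemannianBundle (fun x : M => TangentSpace (𝓡 4) x)]
  [IsContMDiffRiemannianBundle (𝓡 4) ∞ (EuclideanSpace ℝ (Fin 4))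
    (fun x : M => TangentSpace (𝓡 4) x)]
  {cov : Connection M} {J : (x : M) → TangentSpace (𝓡 4) x →L[ℝ] TangentSpace (𝓡 4) x}

lemma IsAlmostHermitian.nablaJ_map (hJ : IsAlmostHermitian J) (x : M)
    (v w : TangentSpace (𝓡 4) x) : nablaJ cov J x (J x w) v = - J x (nablaJ cov J x w v) := by
  have hw := smoothNear_ext w
  have h := hJ.nablaJ_eq (cov := cov) (hJ.smoothNear hw).diffFieldAt v
  have h' := hJ.nablaJ_eq (cov := cov) hw.diffFieldAt v
  simp only [ext_self] at h h'
  have e : (fun y => J y (J y (ext w y))) = - ext w := by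
    ext1 y
    simp [hJ.sq]
  rw [h, h', e, cov_neg cov hw.diffFieldAt, map_sub, hJ.sq]
  simp only [neg_apply]
  abel

lemma IsAlmostHermitian.inner_nablaJ (hcov : IsLeviCivita cov) (hJ : IsAlmostHermitian J) (x : M)
    (v w z : TangentSpace (𝓡 4) x) :
    inner ℝ (nablaJ cov J x w v) z = - inner ℝ (nablaJ cov J x z v) w := by
  have hw := smoothNear_ext w
  have hz := smoothNear_ext z
  have h1 := hcov.dirDeriv_inner (hJ.smoothNear hw).diffFieldAt hz.diffFieldAt v
  have h2 := hcov.dirDeriv_inner (hJ.smoothNear hz).diffFieldAt hw.diffFieldAt v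
  have h3 : dirDeriv (fun y => inner ℝ (J y (ext w y)) (ext z y)) x v =
      - dirDeriv (fun y => inner ℝ (J y (ext z y)) (ext w y)) x v := by
    rw [dirDeriv_congr (g := fun y => -1 * inner ℝ (J y (ext z y)) (ext w y)),
      dirDeriv_const_mul _ ((hJ.smoothNear hz).diffFieldAt.inner hw.diffFieldAt), neg_one_mul]
    exact Filter.Eventually.of_forall fun y => by rw [hJ.inner_map, real_inner_comm, neg_one_mul]
  simp only [ext_self] at h1 h2
  rw [nablaJ, nablaJ]
  simp only [sub_apply, ContinuousLinearMap.comp_apply, inner_sub_left, hJ.inner_map x (cov _ _ _)]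
  rw [real_inner_comm (J x z) (cov (ext w) x v), real_inner_comm (J x w) (cov (ext z) x v)]
  linarith

/-- Integrability of `J` amounts to `∇_{Jv} J = J ∇_v J`. -/
lemma IsHermitian.nablaJ_map_left (hcov : IsLeviCivita cov) (hJ : IsHermitian J) (x : M)
    (v w : TangentSpace (𝓡 4) x) : nablaJ cov J x w (J x v) = J x (nablaJ cov J x w v) := by
  have hJ' := hJ.toIsAlmostHermitian
  have sym : ∀ v w : TangentSpace (𝓡 4) x, nablaJ cov J x w (J x v) - J x (nablaJ cov J x w v) =
      nablaJ cov J x v (J x w) - J x (nablaJ cov J x v w) := by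
    intro v w
    have hv := smoothNear_ext v
    have hw := smoothNear_ext w
    have h := hJ.integrable x _ _ hv.smoothFieldAt hw.smoothFieldAt
    have n1 := fun a => hJ'.nablaJ_eq (cov := cov) hv.diffFieldAt a
    have n2 := fun a => hJ'.nablaJ_eq (cov := cov) hw.diffFieldAt a
    have jv := (hJ'.smoothNear hv).diffFieldAt
    have jw := (hJ'.smoothNear hw).diffFieldAt
    rw [nijenhuis, hcov.mlieBracket_eq jv jw, hcov.mlieBracket_eq jv hw.diffFieldAt,
      hcov.mlieBracket_eq hv.diffFieldAt jw, hcov.mlieBracket_eq hv.diffFieldAt hw.diffFieldAt] at h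
    simp only [ext_self] at h n1 n2
    simp only [n1, n2, map_sub, hJ'.sq] at h ⊢
    rw [← sub_eq_zero, ← h]
    abel
  have skew : ∀ a b c : TangentSpace (𝓡 4) x,
      inner ℝ (nablaJ cov J x b (J x a) - J x (nablaJ cov J x b a)) c =
        - inner ℝ (nablaJ cov J x c (J x a) - J x (nablaJ cov J x c a)) b := by
    intro a b c
    rw [inner_sub_left, inner_sub_left, hJ'.inner_map, hJ'.inner_map,
      hJ'.inner_nablaJ hcov x (J x a) b c, hJ'.inner_nablaJ hcov x a b (J x c), hJ'.nablaJ_map,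
      inner_neg_left, hJ'.inner_map]
    ring
  -- a trilinear form that is symmetric in two arguments and skew in two others vanishes
  refine sub_eq_zero.1 (ext_inner_right ℝ fun z => ?_)
  rw [inner_zero_left]
  have h1 := skew v w z
  have h2 := skew w v z
  have h3 := skew z v w
  rw [sym v z] at h1
  rw [sym w z] at h2
  rw [sym w v] at h2
  linarith

lemma IsHermitian.isHermitianNabla (hcov : IsLeviCivita cov) (hJ : IsHermitian J) (x : M) :
    IsHermitianNabla (hJ.nablaTensor cov x) (J x).toLinearMap where
  sq := hJ.sq x
  isometry := hJ.orthogonal x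
  map_right v w := by simpa using hJ.nablaJ_map x v w
  map_left v w := by simpa using hJ.nablaJ_map_left hcov x v w
  skew v w z := by simpa using hJ.inner_nablaJ hcov x v w z

lemma mem_nullityJ {x : M} {v : TangentSpace (𝓡 4) x} :
    v ∈ nullityJ cov J x ↔ ∀ w, nablaJ cov J x w v = 0 := by
  simp [nullityJ, Submodule.mem_iInf]

/-- The orthogonal projection of a field onto the nullity distribution: as `J J̄ = 2P - 1`, it is
`½(W + J J̄ W)`. -/
lemma starProjection_nullityJ (hJ : IsAlmostHermitian J) (x : M) (w : TangentSpace (𝓡 4) x) :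
    (nullityJ cov J x).starProjection w = (1 / 2 : ℝ) • (w + J x (natOpp cov J x w)) := by
  simp only [natOpp, ContinuousLinearMap.comp_apply, hJ.sq, sub_apply, smul_apply,
    ContinuousLinearMap.id_apply]
  module

lemma smoothNear_starProjection (hJ : IsAlmostHermitian J)
    (hK : IsAlmostHermitian (natOpp cov J)) {W : Field M} {x : M} (hW : SmoothNear W x) :
    SmoothNear (fun y => (nullityJ cov J y).starProjection (W y)) x := by
  simp only [starProjection_nullityJ hJ]
  exact (hW.add (hJ.smoothNear (hK.smoothNear hW))).const_smul _

/-- The nullity space of `∇J` is not trivial if the opposite structure is parallel: the projection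
`P` onto it satisfies `∇P = ½ (∇J) J̄`, and `∇P = 0` at a point where `P` vanishes. -/
lemma nullityJ_ne_bot (hJ : IsAlmostHermitian J) (hK : IsKahler cov (natOpp cov J)) {x : M}
    (hN : ∃ v w, nablaJ cov J x w v ≠ 0) : nullityJ cov J x ≠ ⊥ := by
  intro hbot
  have hP : ∀ {W : Field M}, SmoothNear W x → ∀ v,
      cov (fun y => (nullityJ cov J y).starProjection (W y)) x v =
        (1 / 2 : ℝ) • nablaJ cov J x (natOpp cov J x (W x)) v := by
    intro W hW v
    have hB := hK.smoothNear hW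
    have e : (fun y => (nullityJ cov J y).starProjection (W y)) =
        (1 / 2 : ℝ) • (W + fun y => J y (natOpp cov J y (W y))) := by
      ext1 y
      simp [starProjection_nullityJ hJ]
    have h := hJ.nablaJ_eq (cov := cov) hB.diffFieldAt v
    have hz := starProjection_nullityJ (cov := cov) hJ x (cov W x v)
    rw [hbot, Submodule.starProjection_bot] at hz
    rw [e, cov_const_smul, cov_add cov hW.diffFieldAt (hJ.smoothNear hB).diffFieldAt, h,
      hK.cov_map hW.diffFieldAt]
    · simp only [smul_apply, add_apply]
      have hz' : cov W x v + J x (natOpp cov J x (cov W x v)) = 0 := by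
        refine (smul_eq_zero.1 ?_).resolve_left (by norm_num : (1 / 2 : ℝ) ≠ 0)
        simpa using hz.symm
      rw [sub_eq_neg_add, ← eq_neg_of_add_eq_zero_left hz']
    · exact (hW.add (hJ.smoothNear hB)).diffFieldAt
  obtain ⟨v, w, hvw⟩ := hN
  apply hvw
  -- `W = -J̄w`, so that `J̄W = w`
  have hb := hK.sq x w
  have hW := smoothNear_ext (- natOpp cov J x w)
  have hPW := smoothNear_starProjection hJ hK.toIsAlmostHermitian hW
  have h1 := hP hW v
  have h2 := hP hPW v
  have e : (fun y => (nullityJ cov J y).starProjection ((nullityJ cov J y).starProjection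
      (ext (- natOpp cov J x w) y))) =
      fun y => (nullityJ cov J y).starProjection (ext (- natOpp cov J x w) y) := by
    ext1 y
    exact Submodule.starProjection_eq_self_iff.2 (Submodule.starProjection_apply_mem _ _)
  rw [e, h1] at h2
  have e0 : (nullityJ cov J x).starProjection (ext (- natOpp cov J x w) x) = 0 := by
    rw [hbot]; simp
  have z : nablaJ cov J x 0 v = 0 := map_zero (hJ.nablaTensor cov x v)
  simp only [e0, map_zero, z, smul_zero] at h2
  simp only [ext_self, map_neg, hb, neg_neg] at h2
  simpa using h2

lemma smoothNear_normalize {W : Field M} {x : M} (hW : SmoothNear W x) (h0 : W x ≠ 0) :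
    SmoothNear (fun y => ‖W y‖⁻¹ • W y) x := by
  have hn : SmoothFunNear (fun y => ‖W y‖⁻¹) x := by
    have hne : ∀ᶠ y in 𝓝 x, inner ℝ (W y) (W y) ≠ 0 :=
      (hW.inner hW).self_of_nhds.continuousAt.eventually_ne (inner_self_ne_zero.2 h0)
    filter_upwards [hW.inner hW, hne] with y hy hy0
    have : (fun y => ‖W y‖⁻¹) = (fun t : ℝ => (√t)⁻¹) ∘ fun y => inner ℝ (W y) (W y) := by
      ext1 y
      simp
    rw [this]
    exact ContMDiffAt.comp y (((Real.contDiffAt_sqrt hy0).inv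
      (by simpa using hy0)).contMDiffAt) hy
  exact SmoothNear.smul hn hW

/-- A Hermitian surface with parallel opposite structure has a standard frame near each point. -/
lemma exists_isStandardFrame (hcov : IsLeviCivita cov) (hJ : IsHermitian J)
    (hne : ∀ x, normNablaJ cov J x ≠ 0) (hK : IsKahler cov (natOpp cov J)) (x : M) :
    ∃ (U : Set M) (e : Fin 4 → (x : M) → TangentSpace (𝓡 4) x), x ∈ U ∧
      IsStandardFrame cov J U e := by
  have hJ' := hJ.toIsAlmostHermitian
  have hN : ∀ y, ∃ v w, nablaJ cov J y w v ≠ 0 := by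
    intro y
    by_contra! h
    exact hne y (by simp [normNablaJ, h])
  obtain ⟨u, huD, hu0⟩ : ∃ u ∈ (nullityJ cov J x)ᗮ, u ≠ 0 := by
    refine Submodule.exists_mem_ne_zero_of_ne_bot fun h => ?_
    rw [Submodule.orthogonal_eq_bot_iff] at h
    obtain ⟨v, w, hvw⟩ := hN x
    exact hvw (mem_nullityJ.1 (h ▸ Submodule.mem_top) w)
  -- a section of the orthogonal complement of the nullity distribution
  set W : Field M := fun y => ext u y - (nullityJ cov J y).starProjection (ext u y) with hWdef
  have hW : SmoothNear W x :=
    (smoothNear_ext u).sub (smoothNear_starProjection hJ' hK.toIsAlmostHermitian (smoothNear_ext u))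
  have hWmem : ∀ y, W y ∈ (nullityJ cov J y)ᗮ := fun y =>
    Submodule.sub_starProjection_mem_orthogonal _
  have hWx : W x ≠ 0 := by
    simp only [hWdef, ext_self]
    rwa [(Submodule.starProjection_apply_eq_zero_iff _).2 huD, sub_zero]
  have hW0 : ∀ᶠ y in 𝓝 x, W y ≠ 0 := by
    filter_upwards [(hW.inner hW).self_of_nhds.continuousAt.eventually_ne
      (inner_self_ne_zero.2 hWx)] with y hy using inner_self_ne_zero.1 hy
  set E : Field M := fun y => ‖W y‖⁻¹ • W y with hE
  have hEs : SmoothNear E x := smoothNear_normalize hW hWx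
  have hE1 : ∀ y, W y ≠ 0 → ‖E y‖ = 1 := fun y hy => by
    rw [hE, norm_smul, norm_inv, norm_norm, inv_mul_cancel₀ (norm_ne_zero_iff.2 hy)]
  have hEmem : ∀ y, E y ∈ (nullityJ cov J y)ᗮ := fun y => Submodule.smul_mem _ _ (hWmem y)
  set n : Field M := fun y => nablaJ cov J y (E y) (E y) with hn
  have hns : SmoothNear n x := by
    refine (((hJ'.smoothNear hEs).cov_apply hcov.smooth hEs).sub
      (hJ'.smoothNear (hEs.cov_apply hcov.smooth hEs))).congr ?_
    filter_upwards [hEs] with y hy using hJ'.nablaJ_eq hy.diffFieldAt _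
  set F : Field M := fun y => ‖n y‖⁻¹ • n y with hF
  have hdim : ∀ y : M, Module.finrank ℝ (TangentSpace (𝓡 4) y) = 4 := fun y => by
    change Module.finrank ℝ (EuclideanSpace ℝ (Fin 4)) = 4
    simp
  have std := fun y (hy : W y ≠ 0) => (hJ.isHermitianNabla hcov y).standard_form (hdim y)
    (nullityJ cov J y) (fun v => mem_nullityJ) (nullityJ_ne_bot hJ' hK (hN y)) (hE1 y hy) (hEmem y)
    (hN y) (d := F y) rfl
  have hnx : n x ≠ 0 := by
    intro h
    obtain ⟨-, -, -, f, -, -, f2, -⟩ := std x hWx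
    have := f.orthonormal.1 2
    rw [f2, hF] at this
    simp [h] at this
  have hFs : SmoothNear F x := smoothNear_normalize hns hnx
  obtain ⟨U, hU, hUo, hxU⟩ := eventually_nhds_iff.1 (hW0.and (hEs.and hFs))
  refine ⟨U, ![E, fun y => J y (E y), F, fun y => J y (F y)], hxU, hUo, fun i y hy => ?_,
    fun y hy => ?_, fun y hy => ⟨hEmem y, (std y (hU y hy).1).2.2.1⟩,
    fun y hy => ⟨(std y (hU y hy).1).1, (std y (hU y hy).1).2.1⟩, fun y _ => ⟨rfl, rfl⟩,
    fun y hy a v w => ?_⟩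
  · obtain ⟨-, h1, h2⟩ := hU y hy
    have : SmoothFieldAt ((![E, fun y => J y (E y), F, fun y => J y (F y)] :
        Fin 4 → (x : M) → TangentSpace (𝓡 4) x) i) y := by
      fin_cases i
      · exact h1
      · exact (hJ'.smoothEndAt y).apply_smooth h1
      · exact h2
      · exact (hJ'.smoothEndAt y).apply_smooth h2
    exact this.contMDiffWithinAt
  · obtain ⟨-, -, -, f, f0, f1, f2, f3, -⟩ := std y (hU y hy).1
    convert f.orthonormal using 1
    ext1 i
    fin_cases i
    · exact f0.symm
    · exact f1.symm
    · exact f2.symm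
    · exact f3.symm
  · obtain ⟨-, -, -, f, f0, f1, f2, f3, hs⟩ := std y (hU y hy).1
    have hα : alpha cov J y = ‖hJ'.nablaTensor cov y (E y) (E y)‖ := by
      have hsum := IsHermitianNabla.sum_norm_sq (onb y) f _ hs
      simp only [IsAlmostHermitian.nablaTensor_apply] at hsum ⊢
      have h8 : √(8 : ℝ) = 2 * √2 := by
        rw [show (8 : ℝ) = 2 ^ 2 * 2 by norm_num, Real.sqrt_mul (by norm_num),
          Real.sqrt_sq (by norm_num)]
      have h2 : √(2 : ℝ) ≠ 0 := by positivity
      rw [alpha, normNablaJ, hsum, Real.sqrt_mul (by norm_num), Real.sqrt_sq (norm_nonneg _), h8]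
      field_simp
    have := hs a v w
    rw [← hα, f0, f1, f2, f3] at this
    exact this

end FrameExistence

/-! ### The logarithmic derivative of `α` and the curvature -/

section Main

variable [T2Space M] [RiemannianBundle (fun x : M => TangentSpace (𝓡 4) x)]
  [IsContMDiffRiemannianBundle (𝓡 4) ∞ (EuclideanSpace ℝ (Fin 4))
    (fun x : M => TangentSpace (𝓡 4) x)]
  {cov : Connection M} {J : (x : M) → TangentSpace (𝓡 4) x →L[ℝ] TangentSpace (𝓡 4) x}

lemma alpha_ne_zero {x : M} (h : normNablaJ cov J x ≠ 0) : alpha cov J x ≠ 0 :=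
  mul_ne_zero (by positivity) h

lemma IsStandardFrame.dirDeriv_log_alpha_iff (hcov : IsLeviCivita cov) (hJ : IsAlmostHermitian J)
    (hne : ∀ x, normNablaJ cov J x ≠ 0) (hK : IsKahler cov (natOpp cov J)) {U : Set M}
    {e : Fin 4 → (x : M) → TangentSpace (𝓡 4) x} (hf : IsStandardFrame cov J U e) {x : M}
    (hx : x ∈ U) :
    dirDeriv (fun y => Real.log (alpha cov J y)) x (e 3 x) = alpha cov J x / 2 ↔
      dirDeriv (alpha cov J) x (e 3 x) = alpha cov J x ^ 2 / 2 := by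
  have h0 := alpha_ne_zero (hne x)
  rw [dirDeriv_log ((hf.contMDiffAt_alpha hcov hJ hK hx).mdifferentiableAt (by simp)) h0,
    inv_mul_eq_iff_eq_mul₀ h0]
  constructor <;> intro h <;> linarith

/-- With nullity and `J`-invariant Ricci tensor, `⟨R(E₂,E₄)E₁, E₃⟩ = E₄(α)/2 - α²/4` vanishes. -/
lemma e4LogAlphaEq_of_isFoliatedByEuclidean (hcov : IsLeviCivita cov) (hJ : IsAlmostHermitian J)
    (hne : ∀ x, normNablaJ cov J x ≠ 0) (hK : IsKahler cov (natOpp cov J))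
    (hric : RicciInvariant cov J) (hE : IsFoliatedByEuclidean cov) : E4LogAlphaEq cov J := by
  intro U e hf x hx
  rw [hf.dirDeriv_log_alpha_iff hcov hJ hne hK hx]
  obtain ⟨N, hN2, hN⟩ := hE x
  obtain ⟨n, hn, hn0⟩ : ∃ n ∈ N, n ≠ 0 := by
    refine Submodule.exists_mem_ne_zero_of_ne_bot fun h => ?_
    rw [h, finrank_bot] at hN2
    norm_num at hN2
  have hdim : Module.finrank ℝ (TangentSpace (𝓡 4) x) = 4 := by
    change Module.finrank ℝ (EuclideanSpace ℝ (Fin 4)) = 4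
    simp
  have h := (hK.isKahlerCurvature hcov x).mixed_eq_zero_of_nullity hdim hn0 (hN n hn)
    (hf.isAdapted hx) (J := (J x).toLinearMap) (by simpa using (hf.oriented x hx).1)
    (by simpa using (hf.oriented x hx).2) (hJ.sq x) (hJ.orthogonal x) (onb x) (hric x)
  simp only [IsStandardFrame.basis_apply, IsLeviCivita.curvTensor_apply] at h
  rw [hf.inner_R_one_three hcov hJ hK hx] at h
  linarith

lemma IsStandardFrame.norm_starProjection_sq {U : Set M}
    {e : Fin 4 → (x : M) → TangentSpace (𝓡 4) x} (hf : IsStandardFrame cov J U e) {x : M}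
    (hx : x ∈ U) (v : TangentSpace (𝓡 4) x) :
    ‖(nullityJ cov J x).starProjection v‖ ^ 2 =
      inner ℝ (e 2 x) v ^ 2 + inner ℝ (e 3 x) v ^ 2 := by
  have hP : (nullityJ cov J x).starProjection v =
      inner ℝ (e 2 x) v • e 2 x + inner ℝ (e 3 x) v • e 3 x := by
    have z : ∀ w ∈ (nullityJ cov J x)ᗮ, (nullityJ cov J x).starProjection w = 0 := fun w =>
      (Submodule.starProjection_apply_eq_zero_iff _).2
    have s : ∀ w ∈ nullityJ cov J x, (nullityJ cov J x).starProjection w = w := fun w =>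
      Submodule.starProjection_eq_self_iff.2
    conv_lhs => rw [← (hf.basis hx).sum_repr' v]
    simp [Fin.sum_univ_four, z _ (hf.perp x hx).1, z _ (hf.perp x hx).2, s _ (hf.null x hx).1,
      s _ (hf.null x hx).2]
  rw [hP, ← real_inner_self_eq_norm_sq]
  simp only [inner_add_left, inner_add_right, inner_smul_left, inner_smul_right, hf.inner_eq hx]
  simp
  ring

/-- The hypothesis on `α` says that `⟨R(E₁,E₃)E₁, E₃⟩ = 0`; a QCH curvature tensor with this
property is that of a product of surfaces. -/
lemma isSemiSymmetric_of_e4LogAlphaEq (hcov : IsLeviCivita cov) (hJ : IsHermitian J)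
    (hne : ∀ x, normNablaJ cov J x ≠ 0) (hQ : IsQCH cov (natOpp cov J) (nullityJ cov J))
    (hα : E4LogAlphaEq cov J) : IsSemiSymmetric cov := by
  intro x
  have hK := hQ.kahler
  have hJ' := hJ.toIsAlmostHermitian
  obtain ⟨U, e, hx, hf⟩ := exists_isStandardFrame hcov hJ hne hK x
  have hR := hK.isKahlerCurvature hcov x
  have hmix : inner ℝ (R cov x (e 0 x) (e 2 x) (e 0 x)) (e 2 x) = 0 := by
    have h1 := (hf.dirDeriv_log_alpha_iff hcov hJ' hne hK hx).1 (hα U e hf x hx)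
    have h2 := hf.dirDeriv_alpha_add hcov hJ' hK hx
    rw [hf.inner_R_zero_two_self hcov hJ' hK hx]
    linarith
  obtain ⟨A, B, h⟩ := hR.product_of_holCurv (hf.isAdapted hx) (by simpa using hmix) (by
    intro v w hv hw hvw
    simp only [IsStandardFrame.basis_apply, ← hf.norm_starProjection_sq hx] at hvw
    have h := hQ.holCurv x v w hv hw ((sq_eq_sq₀ (norm_nonneg _) (norm_nonneg _)).1 hvw)
    rw [hcov.R_skew, hcov.R_skew x w] at h
    simpa using h)
  exact semisymmetric_of_product (hf.basis hx) h

end Main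

/-! ### The Lee form -/

section LeeForm

variable [T2Space M] [RiemannianBundle (fun x : M => TangentSpace (𝓡 4) x)]
  {cov : Connection M} {J : (x : M) → TangentSpace (𝓡 4) x →L[ℝ] TangentSpace (𝓡 4) x}

/-- The Lee form, written as minus one half of the metric dual of `J (∑ᵢ (∇_{Eᵢ} J) Eᵢ)`. In a
standard frame this is `-α θ₄`. -/
def leeForm (cov : Connection M) (J : (x : M) → TangentSpace (𝓡 4) x →L[ℝ] TangentSpace (𝓡 4) x)
    (x : M) : TangentSpace (𝓡 4) x →L[ℝ] ℝ :=
  (-(1 / 2) : ℝ) • innerSL ℝ (J x (∑ i, nablaJ cov J x (onb x i) (onb x i)))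

variable {U : Set M} {e : Fin 4 → (x : M) → TangentSpace (𝓡 4) x}

namespace IsStandardFrame

lemma leeForm_apply (hJ : IsAlmostHermitian J) (hf : IsStandardFrame cov J U e) {x : M}
    (hx : x ∈ U) (w : TangentSpace (𝓡 4) x) :
    leeForm cov J x w = inner ℝ (- alpha cov J x • e 3 x) w := by
  have h : inner ℝ (∑ i, nablaJ cov J x (onb x i) (onb x i)) (J x w) =
      2 * alpha cov J x * inner ℝ (e 2 x) (J x w) := by
    have := sum_orthonormalBasis_eq (onb x) (hf.basis hx)
      ((hJ.nablaTensor cov x).compr₂ (innerₗ _ (J x w)))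
    simp only [LinearMap.compr₂_apply, IsAlmostHermitian.nablaTensor_apply, innerₗ_apply_apply,
      real_inner_comm _ (J x w), basis_apply, hf.nablaOmega x hx] at this
    simp only [sum_inner, hf.nablaOmega x hx]
    rw [this]
    simp only [Fin.sum_univ_four, hf.inner_eq hx]
    simp
    ring
  simp only [leeForm, smul_apply, innerSL_apply_apply, smul_eq_mul]
  rw [hJ.inner_map, h, ← (hf.oriented x hx).2, inner_smul_left, hJ.inner_map]
  simp
  ring

lemma kahlerForm_eq (hJ : IsAlmostHermitian J) (hf : IsStandardFrame cov J U e) {x : M}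
    (hx : x ∈ U) (v w : TangentSpace (𝓡 4) x) :
    kahlerForm J x v w =
      inner ℝ (e 0 x) v * inner ℝ (e 1 x) w - inner ℝ (e 1 x) v * inner ℝ (e 0 x) w
      + (inner ℝ (e 2 x) v * inner ℝ (e 3 x) w - inner ℝ (e 3 x) v * inner ℝ (e 2 x) w) := by
  have j1 : J x (e 1 x) = - e 0 x := by rw [← (hf.oriented x hx).1, hJ.sq]
  have j3 : J x (e 3 x) = - e 2 x := by rw [← (hf.oriented x hx).2, hJ.sq]
  rw [kahlerForm]
  conv_lhs => rw [← (hf.basis hx).sum_repr' v]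
  simp only [Fin.sum_univ_four, basis_apply, map_add, map_smul, (hf.oriented x hx).1,
    (hf.oriented x hx).2, j1, j3, inner_add_left, inner_smul_left, inner_neg_left, conj_trivial]
  ring

variable [IsContMDiffRiemannianBundle (𝓡 4) ∞ (EuclideanSpace ℝ (Fin 4))
  (fun x : M => TangentSpace (𝓡 4) x)]

lemma normSqForm_leeForm (hJ : IsAlmostHermitian J) (hf : IsStandardFrame cov J U e) {x : M}
    (hx : x ∈ U) : normSqForm (leeForm cov J) x = alpha cov J x ^ 2 := by
  simp only [normSqForm, hf.leeForm_apply hJ hx]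
  rw [(onb x).sum_sq_inner_left, norm_smul, hf.norm_eq hx]
  simp

lemma codiff_leeForm (hcov : IsLeviCivita cov) (hJ : IsAlmostHermitian J)
    (hK : IsKahler cov (natOpp cov J)) (hf : IsStandardFrame cov J U e) {x : M} (hx : x ∈ U) :
    codiff cov (leeForm cov J) x = dirDeriv (alpha cov J) x (e 3 x) - alpha cov J x ^ 2
      - alpha cov J x * inner ℝ (cov (e 2) x (e 2 x)) (e 3 x) := by
  have hα := hf.contMDiffAt_alpha hcov hJ hK hx
  have hαd := hα.mdifferentiableAt (by simp)
  have h3 := (hf.smoothNear hx 3).diffFieldAt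
  set T : Field M := - (alpha cov J • e 3) with hT
  have hTd : DiffFieldAt (alpha cov J • e 3) x := h3.smul hαd
  have hTd' : DiffFieldAt T x := by
    have h : DiffFieldAt ((fun y => -1 * alpha cov J y) • e 3) x :=
      h3.smul (mdifferentiableAt_const.mul hαd)
    refine h.congr (Filter.Eventually.of_forall fun y => ?_)
    simp [hT]
  -- `θ` is the metric dual of `T = -α E₄`, so `δθ = -div T`
  have hterm : ∀ b : TangentSpace (𝓡 4) x,
      dirDeriv (fun y => leeForm cov J y (ext b y)) x b - leeForm cov J x (cov (ext b) x b)
        = inner ℝ (cov T x b) b := by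
    intro b
    have h := hcov.dirDeriv_inner hTd' (smoothNear_ext b).diffFieldAt b
    rw [dirDeriv_congr (g := fun y => inner ℝ (T y) (ext b y)), h, hf.leeForm_apply hJ hx,
      ext_self]
    · simp [hT]
    · filter_upwards [hf.eventually_mem hx] with y hy
      rw [hf.leeForm_apply hJ hy]
      simp [hT]
  have htr := sum_orthonormalBasis_eq (onb x) (hf.basis hx)
    ((innerₗ (TangentSpace (𝓡 4) x)).comp (cov T x).toLinearMap)
  simp only [LinearMap.comp_apply, innerₗ_apply_apply, basis_apply,
    ContinuousLinearMap.coe_coe] at htr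
  have hcovT : ∀ v, cov T x v =
      - (dirDeriv (alpha cov J) x v • e 3 x + alpha cov J x • cov (e 3) x v) := by
    intro v
    rw [hT, cov_neg cov hTd, neg_apply, cov_smul cov hαd h3, add_comm]
  have G := hf.inner_cov hJ hK hx
  have z := hf.inner_cov_swap hcov hx 3 3 (e 3 x)
  rw [codiff, Finset.sum_congr rfl fun i _ => hterm (onb x i), htr]
  simp only [Fin.sum_univ_four, hcovT, inner_neg_left, inner_add_left, inner_smul_left,
    conj_trivial, hf.inner_eq hx, hf.inner_cov_swap hcov hx 3 0, hf.inner_cov_swap hcov hx 3 1,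
    hf.inner_cov_swap hcov hx 3 2, (G _).2.1, (G _).2.2.2]
  simp
  linear_combination (alpha cov J x / 2) * z

end IsStandardFrame

variable [IsContMDiffRiemannianBundle (𝓡 4) ∞ (EuclideanSpace ℝ (Fin 4))
  (fun x : M => TangentSpace (𝓡 4) x)]

/-- As the connection has no torsion, `dΩ` is the cyclic sum of `∇Ω`. -/
lemma dKahlerForm_eq (hcov : IsLeviCivita cov) (hJ : IsAlmostHermitian J) {X Y Z : Field M} {x : M}
    (hX : DiffFieldAt X x) (hY : DiffFieldAt Y x) (hZ : DiffFieldAt Z x) :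
    dKahlerForm J X Y Z x = inner ℝ (nablaJ cov J x (Y x) (X x)) (Z x)
      + inner ℝ (nablaJ cov J x (Z x) (Y x)) (X x)
      + inner ℝ (nablaJ cov J x (X x) (Z x)) (Y x) := by
  have d : ∀ {A : Field M}, DiffFieldAt A x → DiffFieldAt (fun y => J y (A y)) x := fun hA =>
    (hJ.smoothEndAt x).apply_diff hA
  have c := fun a b : TangentSpace (𝓡 4) x => real_inner_comm a (J x b)
  simp only [dKahlerForm, kahlerForm]
  rw [hcov.dirDeriv_inner (d hY) hZ, hcov.dirDeriv_inner (d hZ) hX, hcov.dirDeriv_inner (d hX) hY,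
    hcov.mlieBracket_eq hX hY, hcov.mlieBracket_eq hY hZ, hcov.mlieBracket_eq hZ hX,
    hJ.nablaJ_eq hX, hJ.nablaJ_eq hY, hJ.nablaJ_eq hZ]
  simp only [map_sub, inner_sub_left]
  have s : ∀ a b : TangentSpace (𝓡 4) x, inner ℝ (J x a) b = - inner ℝ (J x b) a := fun a b => by
    rw [hJ.inner_map, real_inner_comm]
  rw [s (X x), s (Y x), s (Z x)]
  ring

lemma isLeeForm_leeForm (hcov : IsLeviCivita cov) (hJ : IsHermitian J)
    (hne : ∀ x, normNablaJ cov J x ≠ 0) (hK : IsKahler cov (natOpp cov J)) :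
    IsLeeForm J (leeForm cov J) where
  smooth x X hX := by
    obtain ⟨U, e, hx, hf⟩ := exists_isStandardFrame hcov hJ hne hK x
    have hα := hf.contMDiffAt_alpha hcov hJ.toIsAlmostHermitian hK hx
    have h : ContMDiffAt (𝓡 4) 𝓘(ℝ, ℝ) ∞
        (fun y => -1 * (alpha cov J y * inner ℝ (e 3 y) (X y))) x :=
      contMDiffAt_const.mul (hα.mul ((hf.smoothNear hx 3).smoothFieldAt.inner hX))
    refine h.congr_of_eventuallyEq ?_
    filter_upwards [hf.eventually_mem hx] with y hy
    rw [hf.leeForm_apply hJ.toIsAlmostHermitian hy, inner_smul_left]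
    simp
  eq x X Y Z hX hY hZ := by
    have hJ' := hJ.toIsAlmostHermitian
    obtain ⟨U, e, hx, hf⟩ := exists_isStandardFrame hcov hJ hne hK x
    rw [dKahlerForm_eq hcov hJ' hX.diffFieldAt hY.diffFieldAt hZ.diffFieldAt]
    simp only [hf.nablaOmega x hx, hf.leeForm_apply hJ' hx, hf.kahlerForm_eq hJ' hx,
      inner_smul_left, conj_trivial]
    ring

/-- In a standard frame `|θ|² + δθ = E₄(α) - α ⟨∇_{E₃}E₃, E₄⟩`, and both terms equal `α² / 2`. -/
lemma scalarCurv_sub_conformalScalar (hcov : IsLeviCivita cov) (hJ : IsHermitian J)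
    (hne : ∀ x, normNablaJ cov J x ≠ 0) (hK : IsKahler cov (natOpp cov J))
    (hα : E4LogAlphaEq cov J) (x : M) :
    scalarCurv cov x - conformalScalar cov (leeForm cov J) x = 0 := by
  have hJ' := hJ.toIsAlmostHermitian
  obtain ⟨U, e, hx, hf⟩ := exists_isStandardFrame hcov hJ hne hK x
  have h1 := (hf.dirDeriv_log_alpha_iff hcov hJ' hne hK hx).1 (hα U e hf x hx)
  have h2 := hf.dirDeriv_alpha_add hcov hJ' hK hx
  rw [conformalScalar, hf.normSqForm_leeForm hJ' hx, hf.codiff_leeForm hcov hJ' hK hx]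
  linarith

end LeeForm

end HermSurf

end

theorem lemmaF {M : Type*} [TopologicalSpace M] [T2Space M] [ChartedSpace (EuclideanSpace ℝ (Fin 4)) M]
    [IsManifold (𝓡 4) ∞ M]
    [RiemannianBundle (fun x : M => TangentSpace (𝓡 4) x)]
    [IsContMDiffRiemannianBundle (𝓡 4) ∞ (EuclideanSpace ℝ (Fin 4)) (fun x : M => TangentSpace (𝓡 4) x)]
    (cov : HermSurf.Connection M) (hcov : HermSurf.IsLeviCivita cov)
    (J : (x : M) → TangentSpace (𝓡 4) x →L[ℝ] TangentSpace (𝓡 4) x) (hJ : HermSurf.IsHermitian J)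
    (hne : ∀ x, HermSurf.normNablaJ cov J x ≠ 0)
    (hK : HermSurf.IsKahler cov (HermSurf.natOpp cov J)) :
    (HermSurf.RicciInvariant cov J → HermSurf.IsSemiSymmetric cov →
      HermSurf.IsFoliatedByEuclidean cov → HermSurf.E4LogAlphaEq cov J) ∧
    (HermSurf.IsQCH cov (HermSurf.natOpp cov J) (HermSurf.nullityJ cov J) →
      HermSurf.E4LogAlphaEq cov J →
      HermSurf.IsSemiSymmetric cov ∧
      ∃ θ : (x : M) → TangentSpace (𝓡 4) x →L[ℝ] ℝ, HermSurf.IsLeeForm J θ ∧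
        ∀ x, HermSurf.scalarCurv cov x - HermSurf.conformalScalar cov θ x = 0) := by
  refine ⟨fun hric _ hE => ?_, fun hQ hα => ⟨?_, HermSurf.leeForm cov J, ?_, ?_⟩⟩
  · exact HermSurf.e4LogAlphaEq_of_isFoliatedByEuclidean hcov hJ.toIsAlmostHermitian hne hK hric hE
  · exact HermSurf.isSemiSymmetric_of_e4LogAlphaEq hcov hJ hne hQ hα
  · exact HermSurf.isLeeForm_leeForm hcov hJ hne hK
  · exact HermSurf.scalarCurv_sub_conformalScalar hcov hJ hne hK hα
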